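/- Notation. $\mathcal N_{\mathbb R}(0,\sigma^2)$ is the real Gaussian law, and $\mathcal N_{\mathbb C}(0,1)$ is the law of $\gamma+i\delta$ with $\gamma,\delta\sim\mathcal N_{\mathbb R}(0,\tfrac12)$ independent. For $\mathbb F\in\{\mathbb R,\mathbb C\}$, $\chi^2_{\mathbb F}(k)$ is the law of $\sum_{i=1}^k|\delta_i|^2$ with $\delta_i\sim\mathcal N_{\mathbb F}(0,1)$ independent. $\operatorname{Arg}$ is the principal argument, with values in $(-\pi,\pi]$ (and $\operatorname{Arg}0=0$). The joint eigenvalue distribution of a random $n\times n$ matrix is the law of its unordered $n$-tuple of eigenvalues, counted with algebraic multiplicity. Haar measures are normalized to be probability measures. Let $n\ge 1$, and let $w_j=(\alpha_j,\beta_j)$, $j=1,\dots,n-1$, be independent random vectors in $\mathbb F^2$ such that, for each $j$, $\alpha_j$ and $\beta_j$ are independent, $\alpha_j\sim\mathcal N_{\mathbb F}(0,1)$ and $\beta_j^2\sim\chi^2_{\mathbb F}(n-j)$. For $j\le n-1$ put $\theta_j=\operatorname{Arg}\alpha_j$, $$v_j=\begin{bmatrix}0_{j-1}\\ \alpha_j+e^{i\theta_j}\|w_j\|_2\\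 \beta_j\\ 0_{n-j-1}\end{bmatrix},\qquad P_j=I-\frac{2}{\|v_j\|_2^2}v_jv_j^*$$ (with $P_j=I$ on the null event $v_j=0$), and let $$H=P_1\cdots P_{n-1}D,\qquad D=\operatorname{diag}(d_{11},\dots,d_{nn}),\qquad d_{jj}=-e^{i\theta_j}\ \ (1\le j\le n-1),$$ with $d_{nn}$ as specified below. Then the following hold. 1. ($U(n)$.) Let $\mathbb F=\mathbb C$ and $d_{nn}=-e^{i\theta_n}$ with $\theta_n$ uniform on $(-\pi,\pi]$ and independent of $(w_1,\dots,w_{n-1})$. Then $H$ is unitary and upper Hessenberg, and its joint eigenvalue distribution is that of a Haar-distributed matrix of $U(n)$. 2. ($SU(n)$ and fixed determinant.) Let $\mathbb F=\mathbb C$, $\xi\in\mathbb C$ with $|\xi|=1$, and $d_{nn}=(-1)^{n-1}\,\xi\prod_{i=1}^{n-1}\overline{d_{ii}}$. Then $H$ is unitary and upper Hessenberg, $\det H=\xi$ almost surely, and for every unitary $U$ with $\det U=\xi$ the joint eigenvalue distribution of $H$ is that of $UQ$ with $Q$ Haar-distributed in $SU(n)$ (that is, of the Haar measure of $U(n)$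 conditioned on $\det=\xi$). For $\xi=1$, $U=I$ this is the joint eigenvalue distribution of a Haar-distributed matrix of $SU(n)$. 3. ($O(n)$.) Let $\mathbb F=\mathbb R$ and $d_{nn}=-e^{i\theta_n}$ with $\theta_n$ uniform on $\{0,\pi\}$ and independent of $(w_1,\dots,w_{n-1})$. Then $H$ is upper Hessenberg and almost surely real orthogonal, and its joint eigenvalue distribution is that of a Haar-distributed matrix of $O(n)$. 4. ($SO(n)$ and fixed determinant.) Let $\mathbb F=\mathbb R$, $\xi\in\{1,-1\}$ and $d_{nn}=(-1)^{n-1}\,\xi\prod_{i=1}^{n-1}d_{ii}$. Then $H$ is real orthogonal and upper Hessenberg, $\det H=\xi$ almost surely, and for every orthogonal $U$ with $\det U=\xi$ the joint eigenvalue distribution of $H$ is that of $UQ$ with $Q$ Haar-distributed in $SO(n)$. For $\xi=1$, $U=I$ this is the joint eigenvalue distribution of a Haar-distributed matrix of $SO(n)$. -/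

import Mathlib

open MeasureTheory ProbabilityTheory
open scoped NNReal

noncomputable section

namespace HaarHess

/-! ### Probability distributions -/

/-- The complex Gaussian law `N_ℂ(c, s)`: independent real and imaginary parts with laws
`N_ℝ(Re c, s / 2)` and `N_ℝ(Im c, s / 2)`. The second argument is the variance. -/
def complexGaussian (c : ℂ) (s : ℝ≥0) : Measure ℂ :=
  ((gaussianReal c.re (s / 2)).prod (gaussianReal c.im (s / 2))).map
    (fun p : ℝ × ℝ => (p.1 : ℂ) + (p.2 : ℂ) * Complex.I)

/-- The real chi-squared law with `k` degrees of freedom: the law of `∑ δ_i ^ 2` for `k`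
independent standard real Gaussian variables `δ_i`. -/
def chiSqReal (k : ℕ) : Measure ℝ :=
  (Measure.pi (fun _ : Fin k => gaussianReal 0 1)).map (fun δ => ∑ i, (δ i) ^ 2)

/-- The complex chi-squared law with `k` degrees of freedom: the law of `∑ |δ_i| ^ 2` for `k`
independent standard complex Gaussian variables `δ_i`. -/
def chiSqComplex (k : ℕ) : Measure ℝ :=
  (Measure.pi (fun _ : Fin k => complexGaussian 0 1)).map (fun δ => ∑ i, ‖δ i‖ ^ 2)

/-! ### Eigenvalues as unordered tuples -/

/-- The unordered tuple (with multiplicities) underlying an ordered one. -/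
def unordered {n : ℕ} (x : Fin n → ℂ) : Sym ℂ n :=
  ⟨(Finset.univ : Finset (Fin n)).val.map x, by simp⟩

/-- The sigma-algebra on unordered `n`-tuples of complex numbers: the quotient of the Borel
sigma-algebra of `ℂ ^ n`. A set is measurable iff the symmetric set of its orderings is Borel. -/
instance instMeasurableSpaceSym (n : ℕ) : MeasurableSpace (Sym ℂ n) :=
  MeasurableSpace.map unordered MeasurableSpace.pi

/-- The product sigma-algebra on matrices (the Borel one for real or complex matrices). Matrix
groups carry the induced sigma-algebra. -/
instance instMeasurableSpaceMatrix {m n R : Type*} [MeasurableSpace R] :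
    MeasurableSpace (Matrix m n R) :=
  inferInstanceAs (MeasurableSpace (m → n → R))

/-- The eigenvalues of a complex matrix, with algebraic multiplicities, as an unordered tuple. The
joint eigenvalue distribution of a random matrix is the law of this random unordered tuple. -/
def eigenvalues {n : ℕ} (A : Matrix (Fin n) (Fin n) ℂ) : Sym ℂ n :=
  ⟨A.charpoly.roots, by
    rw [IsAlgClosed.card_roots_eq_natDegree, Matrix.charpoly_natDegree_eq_dim, Fintype.card_fin]⟩

/-! ### Reflectors and the Hessenberg matrix -/

/-- Entries below the first subdiagonal vanish. -/
def IsUpperHessenberg {n : ℕ} (A : Matrix (Fin n) (Fin n) ℂ) : Prop :=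
  ∀ i j : Fin n, (j : ℕ) + 1 < (i : ℕ) → A i j = 0

/-- The Householder transformation `I - (2 / ‖v‖₂²) v v*` (the identity when `v = 0`). -/
def householder {n : ℕ} (v : Fin n → ℂ) : Matrix (Fin n) (Fin n) ℂ :=
  1 - ((2 / ∑ i, ‖v i‖ ^ 2 : ℝ) : ℂ) • Matrix.vecMulVec v (star v)

/-- The unimodular number `exp (i Arg z)`. -/
def phase (z : ℂ) : ℂ := Complex.exp ((Complex.arg z : ℂ) * Complex.I)

/-- The vector of length `m + 1` whose entries in the (zero-based) positions `j` and `j + 1` are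
`a + exp (i Arg a) ‖(a, b)‖₂` and `b`, and whose other entries vanish. -/
def reflectorVector {m : ℕ} (j : Fin m) (a b : ℂ) : Fin (m + 1) → ℂ :=
  fun i =>
    if i = j.castSucc then a + phase a * (Real.sqrt (‖a‖ ^ 2 + ‖b‖ ^ 2) : ℂ)
    else if i = j.succ then b
    else 0

/-- The matrix `P₁ P₂ ⋯ P_m D` of order `m + 1`, where `P_j` is the Householder transformation built
from `(a j, b j)` and `D` is diagonal with entries `-exp (i Arg (a j))`, except for the last one,
which is `d`. -/
def hessenbergProduct {m : ℕ} (a b : Fin m → ℂ) (d : ℂ) :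
    Matrix (Fin (m + 1)) (Fin (m + 1)) ℂ :=
  (List.ofFn fun j : Fin m => householder (reflectorVector j (a j) (b j))).prod *
    Matrix.diagonal (Fin.snoc (α := fun _ => ℂ) (fun j : Fin m => -phase (a j)) d)

/-- The last diagonal entry of `D` which prescribes the determinant `ξ`: in order `n = m + 1` it is
`(-1) ^ (n - 1) ξ ∏ conj (d_i)`, where `d_i = -exp (i Arg (a i))` for `i < n`. -/
def lastEntry {m : ℕ} (ξ : ℂ) (a : Fin m → ℂ) : ℂ :=
  (-1) ^ m * ξ * ∏ j : Fin m, star (-phase (a j))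

/-! ### The random input

The order of the matrix is `n = m + 1`. The zero-based index `j : Fin m` stands for the one-based
index `j + 1`, so that the number of degrees of freedom is `n - (j + 1) = m - j`. -/

/-- Independent random vectors `(α_j, β_j)` in `ℂ ^ 2` with independent components,
`α_j ~ N_ℂ(0, 1)` and `β_j ^ 2` complex chi-squared. Any square root `β_j` is allowed. -/
structure IsComplexInput {Ω : Type*} [MeasurableSpace Ω] (P : Measure Ω) (m : ℕ)
    (α β : Fin m → Ω → ℂ) : Prop where
  law_alpha : ∀ j, HasLaw (α j) (complexGaussian 0 1) P
  aemeasurable_beta : ∀ j, AEMeasurable (β j) P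
  law_beta_sq : ∀ j : Fin m,
    HasLaw (fun ω => β j ω ^ 2) ((chiSqComplex (m - j)).map (fun x : ℝ => (x : ℂ))) P
  indep_components : ∀ j, IndepFun (α j) (β j) P
  indep_pairs : iIndepFun (fun j ω => (α j ω, β j ω)) P

/-- Independent random vectors `(α_j, β_j)` in `ℝ ^ 2` with independent components,
`α_j ~ N_ℝ(0, 1)` and `β_j ^ 2` real chi-squared. Any square root `β_j` is allowed. -/
structure IsRealInput {Ω : Type*} [MeasurableSpace Ω] (P : Measure Ω) (m : ℕ)
    (α β : Fin m → Ω → ℝ) : Prop where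
  law_alpha : ∀ j, HasLaw (α j) (gaussianReal 0 1) P
  aemeasurable_beta : ∀ j, AEMeasurable (β j) P
  law_beta_sq : ∀ j : Fin m, HasLaw (fun ω => β j ω ^ 2) (chiSqReal (m - j)) P
  indep_components : ∀ j, IndepFun (α j) (β j) P
  indep_pairs : iIndepFun (fun j ω => (α j ω, β j ω)) P

/-- The entrywise inclusion of real matrices into complex ones. -/
def toComplex {n : ℕ} (A : Matrix (Fin n) (Fin n) ℝ) : Matrix (Fin n) (Fin n) ℂ :=
  A.map (fun x : ℝ => (x : ℂ))

/-- A normalized Haar measure on a group, given as a left-invariant probability measure. -/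
structure IsNormalizedHaar {G : Type*} [Mul G] [MeasurableSpace G] (ν : Measure G) : Prop where
  isProbability : IsProbabilityMeasure ν
  left_invariant : ∀ (g : G) (S : Set G), MeasurableSet S → ν ((fun x => g * x) '' S) = ν S

end HaarHess

end

open MeasureTheory ProbabilityTheory HaarHess

open scoped NNReal ENNReal

noncomputable section

namespace HaarHess

open Matrix

set_option linter.unusedSectionVars false

/-! Reducing a matrix to Hessenberg form by Householder steps conjugates it by matrices `1 ⊕ V` with
`V` unitary, so it keeps the eigenvalues. The proof builds Haar measure in a way that makes this
reduction visible, for `ℝ` and `ℂ` at once.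

Haar measure on the coset of determinant `ξ` is obtained recursively. For an isotropic vector `x`,
let `V(x)` be unitary with first column `x / ‖x‖`, let `y` be Haar in the special unitary group one
size smaller, and let `A = V(x) (1 ⊕ D(x) y)`, where `D(x)` corrects the determinant. A left factor
`s` turns `V(x)` into `V(s x) (1 ⊕ S)`; isotropy absorbs `s x` and the invariance of `y` absorbs the
rest (`isCosetHaar_extendedLaw`).

Now `V(x) = (1 ⊕ T) B`, where `B` acts on the first two coordinates and depends only on `x 0` and
the norm of the tail of `x`. Conjugation by `1 ⊕ T*` turns `A` into `B (1 ⊕ D y T)`. Given `x`, the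
matrix `D y T` is Haar on a coset whose determinant depends on `x 0` alone, and `M ↦ f (B (1 ⊕ M))`
inherits the conjugation invariance of `f`, since `B` commutes with `1 ⊕ 1 ⊕ V`. Induction on the
size then gives the Hessenberg product (`exists_isCosetHaar_lintegral_eq`), and uniqueness of the
coset measure (`IsCosetHaar.lintegral_eq`) transfers this to any Haar measure.

For the full group, the matrix given its determinant is Haar on a coset, and the determinant is
uniform (`lintegral_eq_hess_of_unitary_invariant`). It remains that `P₁ ⋯ P_m D` is the recursive
matrix `hess`, that the signs of the `β_j` are irrelevant, that Gaussian vectors are isotropic, and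
that the unordered spectrum is a measurable function of the matrix. -/

lemma ext_fin_succ {R : Type*} {n : ℕ} {A B : Matrix (Fin (n + 1)) (Fin (n + 1)) R} (h00 : A 0 0 = B 0 0)
    (h0s : ∀ j : Fin n, A 0 j.succ = B 0 j.succ) (hs0 : ∀ i : Fin n, A i.succ 0 = B i.succ 0)
    (hss : ∀ i j : Fin n, A i.succ j.succ = B i.succ j.succ) : A = B := by
  ext i j
  refine Fin.cases (Fin.cases h00 h0s j) (fun i => Fin.cases (hs0 i) (hss i) j) i

section linearAlgebra

variable {𝕜 : Type*} [RCLike 𝕜]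

/-! ### Householder frames -/

/-- The Euclidean norm of a tuple. -/
def nrm {n : ℕ} (x : Fin n → 𝕜) : ℝ := Real.sqrt (∑ i, ‖x i‖ ^ 2)

/-- `z / |z|`, or `1` for `z = 0`. -/
def unitPhase (z : 𝕜) : 𝕜 := if z = 0 then 1 else z / (‖z‖ : 𝕜)

/-- The Householder reflector `1 - (2 / ‖v‖²) v v*`. -/
def reflector {n : ℕ} (v : Fin n → 𝕜) : Matrix (Fin n) (Fin n) 𝕜 :=
  1 - ((2 / ∑ i, ‖v i‖ ^ 2 : ℝ) : 𝕜) • vecMulVec v (star v)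

/-- The vector `x + (x₀ / |x₀|) ‖x‖ e₀`. -/
def shifted {n : ℕ} (x : Fin (n + 1) → 𝕜) : Fin (n + 1) → 𝕜 :=
  x + Pi.single 0 (unitPhase (x 0) * (nrm x : 𝕜))

/-- A unitary matrix whose first column is `x / ‖x‖`. -/
def frame {n : ℕ} (x : Fin (n + 1) → 𝕜) : Matrix (Fin (n + 1)) (Fin (n + 1)) 𝕜 :=
  reflector (shifted x) * diagonal (Fin.cons (-unitPhase (x 0)) 1)

/-- The matrix `1 ⊕ M`. -/
def bordered {n : ℕ} (M : Matrix (Fin n) (Fin n) 𝕜) : Matrix (Fin (n + 1)) (Fin (n + 1)) 𝕜 :=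
  Matrix.of (Fin.cons (Pi.single 0 1) fun i => Fin.cons 0 (M i))

section bordered

variable {n : ℕ} (M N : Matrix (Fin n) (Fin n) 𝕜)

@[simp] lemma bordered_zero_zero : bordered M 0 0 = 1 := by simp [bordered]
@[simp] lemma bordered_zero_succ (j : Fin n) : bordered M 0 j.succ = 0 := by simp [bordered]
@[simp] lemma bordered_succ_zero (i : Fin n) : bordered M i.succ 0 = 0 := by simp [bordered]
@[simp] lemma bordered_succ_succ (i j : Fin n) : bordered M i.succ j.succ = M i j := by
  simp [bordered]

lemma bordered_mul : bordered (M * N) = bordered M * bordered N := by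
  apply ext_fin_succ <;> intros <;> simp [Matrix.mul_apply, Fin.sum_univ_succ]

@[simp] lemma bordered_one : bordered (1 : Matrix (Fin n) (Fin n) 𝕜) = 1 := by
  apply ext_fin_succ <;> intros <;> simp [Matrix.one_apply, Fin.succ_ne_zero, (Fin.succ_ne_zero _).symm]

lemma bordered_star : bordered (star M) = star (bordered M) := by
  apply ext_fin_succ <;> intros <;> simp [Matrix.star_apply]

lemma bordered_prod (l : List (Matrix (Fin n) (Fin n) 𝕜)) :
    bordered l.prod = (l.map bordered).prod := by
  induction l with
  | nil => simp
  | cons a l ih => simp [bordered_mul, ih]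

lemma det_bordered : (bordered M).det = M.det := by
  rw [det_succ_row_zero, Fin.sum_univ_succ]
  have : (bordered M).submatrix Fin.succ Fin.succ = M := by
    ext i j; simp
  simp [this]

lemma bordered_mem_unitary {M : Matrix (Fin n) (Fin n) 𝕜} (hM : M ∈ unitaryGroup (Fin n) 𝕜) :
    bordered M ∈ unitaryGroup (Fin (n + 1)) 𝕜 := by
  rw [mem_unitaryGroup_iff] at *
  rw [← bordered_star, ← bordered_mul, hM, bordered_one]

lemma bordered_diagonal (d : Fin n → 𝕜) :
    bordered (diagonal d) = diagonal (Fin.cons 1 d) := by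
  apply ext_fin_succ <;> intros <;>
    simp [Matrix.diagonal_apply, Fin.succ_ne_zero, (Fin.succ_ne_zero _).symm]

/-- The two factors act on complementary coordinates. This lets each diagonal entry of `D` move left
past the later reflectors to its own one. -/
lemma diagonal_cons_mul_bordered (z : 𝕜) :
    diagonal (Fin.cons z 1) * bordered M = bordered M * diagonal (Fin.cons z 1) := by
  apply ext_fin_succ <;> intros <;> simp

lemma bordered_mulVec_zero (x : Fin (n + 1) → 𝕜) : (bordered M *ᵥ x) 0 = x 0 := by
  simp [Matrix.mulVec, dotProduct, Fin.sum_univ_succ]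

lemma bordered_mulVec_succ (x : Fin (n + 1) → 𝕜) (i : Fin n) :
    (bordered M *ᵥ x) i.succ = (M *ᵥ Fin.tail x) i := by
  simp [Matrix.mulVec, dotProduct, Fin.sum_univ_succ, Fin.tail]

lemma bordered_mulVec_cons (a : 𝕜) (x : Fin n → 𝕜) :
    bordered M *ᵥ (Fin.cons a x : Fin (n + 1) → 𝕜) = Fin.cons a (M *ᵥ x) := by
  ext i
  refine Fin.cases ?_ (fun i => ?_) i
  · simp [bordered_mulVec_zero]
  · rw [bordered_mulVec_succ]; simp

end bordered

lemma nrm_nonneg {n : ℕ} (x : Fin n → 𝕜) : 0 ≤ nrm x := Real.sqrt_nonneg _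

lemma nrm_sq {n : ℕ} (x : Fin n → 𝕜) : nrm x ^ 2 = ∑ i, ‖x i‖ ^ 2 :=
  Real.sq_sqrt (by positivity)

lemma nrm_sq_coe {n : ℕ} (x : Fin n → 𝕜) : ((nrm x : ℝ) : 𝕜) ^ 2 = star x ⬝ᵥ x := by
  rw [← RCLike.ofReal_pow, nrm_sq]
  simp [dotProduct, RCLike.conj_mul]

lemma nrm_eq_zero {n : ℕ} {x : Fin n → 𝕜} : nrm x = 0 ↔ x = 0 := by
  rw [nrm, Real.sqrt_eq_zero (by positivity), Finset.sum_eq_zero_iff_of_nonneg (by intros; positivity)]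
  simp [funext_iff]

lemma nrm_mulVec {n : ℕ} {U : Matrix (Fin n) (Fin n) 𝕜} (hU : U ∈ unitaryGroup (Fin n) 𝕜)
    (x : Fin n → 𝕜) : nrm (U *ᵥ x) = nrm x := by
  have : ((nrm (U *ᵥ x) : ℝ) : 𝕜) ^ 2 = ((nrm x : ℝ) : 𝕜) ^ 2 := by
    rw [nrm_sq_coe, nrm_sq_coe, star_mulVec, dotProduct_mulVec, vecMul_vecMul,
      ← star_eq_conjTranspose, mem_unitaryGroup_iff'.1 hU, vecMul_one]
  rw [← RCLike.ofReal_pow, ← RCLike.ofReal_pow, RCLike.ofReal_inj] at this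
  exact (pow_left_inj₀ (nrm_nonneg _) (nrm_nonneg _) two_ne_zero).1 this

lemma norm_unitPhase (z : 𝕜) : ‖unitPhase z‖ = 1 := by
  unfold unitPhase
  split_ifs with h
  · simp
  · simp [norm_ne_zero_iff.2 h]

lemma unitPhase_mul_star (z : 𝕜) : unitPhase z * star (unitPhase z) = 1 := by
  rw [RCLike.star_def, RCLike.mul_conj, norm_unitPhase]; simp

lemma star_unitPhase_mul (z : 𝕜) : star (unitPhase z) * z = (‖z‖ : 𝕜) := by
  unfold unitPhase
  split_ifs with h
  · simp [h]
  · have : (‖z‖ : 𝕜) ≠ 0 := by simpa using h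
    rw [star_div₀, div_mul_eq_mul_div, RCLike.star_def, RCLike.conj_mul]
    simp only [RCLike.conj_ofReal]
    field_simp

lemma unitPhase_neg_mem (z : 𝕜) : ‖-unitPhase z‖ = 1 := by rw [norm_neg, norm_unitPhase]

lemma diagonal_mem_unitary {n : ℕ} {d : Fin n → 𝕜} (hd : ∀ i, ‖d i‖ = 1) :
    diagonal d ∈ unitaryGroup (Fin n) 𝕜 := by
  rw [mem_unitaryGroup_iff, star_eq_conjTranspose, diagonal_conjTranspose, diagonal_mul_diagonal,
    ← diagonal_one]
  congr 1
  ext i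
  simp [RCLike.mul_conj, hd i]

lemma diagonal_cons_mem_unitary {n : ℕ} {z : 𝕜} (hz : ‖z‖ = 1) :
    diagonal (Fin.cons z 1 : Fin (n + 1) → 𝕜) ∈ unitaryGroup (Fin (n + 1)) 𝕜 :=
  diagonal_mem_unitary fun i => by refine Fin.cases ?_ (fun i => ?_) i <;> simp [hz]

lemma det_diagonal_cons {n : ℕ} (z : 𝕜) :
    (diagonal (Fin.cons z 1 : Fin (n + 1) → 𝕜)).det = z := by
  simp [det_diagonal, Fin.prod_univ_succ]

lemma reflector_star {n : ℕ} (v : Fin n → 𝕜) : star (reflector v) = reflector v := by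
  simp [reflector, star_eq_conjTranspose, conjTranspose_vecMulVec]

lemma reflector_zero {n : ℕ} : reflector (0 : Fin n → 𝕜) = 1 := by
  simp [reflector]

lemma reflector_mulVec {n : ℕ} (v x : Fin n → 𝕜) :
    reflector v *ᵥ x = x - (((2 / nrm v ^ 2 : ℝ) : 𝕜) * (star v ⬝ᵥ x)) • v := by
  rw [reflector, sub_mulVec, one_mulVec, smul_mulVec, ← nrm_sq]
  congr 1
  ext i
  simp [vecMulVec_mulVec, mul_comm, mul_left_comm]

lemma reflector_mul_self {n : ℕ} (v : Fin n → 𝕜) : reflector v * reflector v = 1 := by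
  by_cases h : v = 0
  · simp [h, reflector_zero]
  have hr : (nrm v : 𝕜) ≠ 0 := by simpa using (nrm_eq_zero (x := v)).not.2 h
  rw [reflector, ← nrm_sq]
  have hv : vecMulVec v (star v) * vecMulVec v (star v)
      = ((nrm v : 𝕜) ^ 2) • vecMulVec v (star v) := by
    rw [vecMulVec_mul_vecMulVec, nrm_sq_coe]
    ext i j; simp [vecMulVec_apply]; ring
  rw [sub_mul, one_mul, mul_sub, mul_one, smul_mul_smul_comm, hv, smul_smul]
  have : (((2 / nrm v ^ 2 : ℝ) : 𝕜) * ((2 / nrm v ^ 2 : ℝ) : 𝕜)) * (nrm v : 𝕜) ^ 2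
      = 2 * ((2 / nrm v ^ 2 : ℝ) : 𝕜) := by
    push_cast; field_simp
  rw [this, mul_smul, two_smul]
  abel

lemma reflector_mem_unitary {n : ℕ} (v : Fin n → 𝕜) : reflector v ∈ unitaryGroup (Fin n) 𝕜 := by
  rw [mem_unitaryGroup_iff, reflector_star, reflector_mul_self]

/-- Matrix determinant lemma for a rank-one perturbation: the value is `1 - 2 = -1`. -/
lemma det_reflector {n : ℕ} {v : Fin n → 𝕜} (hv : v ≠ 0) : (reflector v).det = -1 := by
  have hr : (nrm v : 𝕜) ≠ 0 := by simpa using (nrm_eq_zero (x := v)).not.2 hv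
  have h : reflector v = 1 + replicateCol Unit (-((2 / nrm v ^ 2 : ℝ) : 𝕜) • v) *
      replicateRow Unit (star v) := by
    ext i j
    simp [reflector, ← nrm_sq, vecMulVec_apply, Matrix.mul_apply]
    ring
  rw [h, det_one_add_replicateCol_mul_replicateRow, dotProduct_smul, ← nrm_sq_coe]
  simp only [smul_eq_mul]
  push_cast
  field_simp
  norm_num

lemma reflector_conj {n : ℕ} {W : Matrix (Fin n) (Fin n) 𝕜} (hW : W ∈ unitaryGroup (Fin n) 𝕜)
    (v : Fin n → 𝕜) : reflector (W *ᵥ v) = W * reflector v * star W := by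
  rw [reflector, reflector, ← nrm_sq, ← nrm_sq, nrm_mulVec hW, mul_sub, sub_mul, mul_one,
    mem_unitaryGroup_iff.1 hW, mul_smul_comm, smul_mul_assoc, mul_vecMulVec, vecMulVec_mul,
    star_mulVec, star_eq_conjTranspose]

lemma frame_mem_unitary {n : ℕ} (x : Fin (n + 1) → 𝕜) :
    frame x ∈ unitaryGroup (Fin (n + 1)) 𝕜 :=
  mul_mem (reflector_mem_unitary _) (diagonal_cons_mem_unitary (unitPhase_neg_mem _))

lemma star_shifted_dotProduct {n : ℕ} (x : Fin (n + 1) → 𝕜) :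
    star (shifted x) ⬝ᵥ x = ((nrm x * (nrm x + ‖x 0‖) : ℝ) : 𝕜) := by
  rw [shifted, star_add, add_dotProduct, ← nrm_sq_coe, Pi.star_single, single_dotProduct,
    star_mul, mul_assoc, star_unitPhase_mul]
  simp
  ring

/-- The shift has the phase of `x 0`, so the cross terms add up instead of cancelling. The result is
twice the inner product in `star_shifted_dotProduct`, which makes the coefficient in the reflection
of `x` exactly `1`. -/
lemma nrm_shifted_sq {n : ℕ} (x : Fin (n + 1) → 𝕜) :
    nrm (shifted x) ^ 2 = 2 * (nrm x * (nrm x + ‖x 0‖)) := by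
  rw [← RCLike.ofReal_inj (K := 𝕜), RCLike.ofReal_pow, nrm_sq_coe]
  nth_rw 2 [shifted]
  rw [dotProduct_add, star_shifted_dotProduct, dotProduct_single, Pi.star_apply, shifted,
    Pi.add_apply, Pi.single_eq_same, star_add, star_mul, add_mul]
  have h1 : star (x 0) * (unitPhase (x 0) * (nrm x : 𝕜)) = (‖x 0‖ : 𝕜) * nrm x := by
    rw [← mul_assoc]
    congr 1
    have := congrArg star (star_unitPhase_mul (x 0))
    rw [star_mul, star_star] at this
    rw [this]; simp
  have h2 : star (nrm x : 𝕜) * star (unitPhase (x 0)) * (unitPhase (x 0) * (nrm x : 𝕜))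
      = (nrm x : 𝕜) * nrm x := by
    have := unitPhase_mul_star (x 0)
    have h3 : star (nrm x : 𝕜) = nrm x := by simp
    rw [h3]
    linear_combination (nrm x : 𝕜) * nrm x * this
  rw [h1, h2]
  push_cast
  ring

lemma shifted_eq_zero {n : ℕ} {x : Fin (n + 1) → 𝕜} : shifted x = 0 ↔ x = 0 := by
  constructor
  · intro h
    have := nrm_shifted_sq x
    rw [h, nrm_eq_zero.2 rfl] at this
    have h1 := nrm_nonneg x
    have h2 := norm_nonneg (x 0)
    rw [← nrm_eq_zero]
    nlinarith [mul_nonneg h1 h2]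
  · rintro rfl
    simp [shifted, nrm_eq_zero.2]

lemma reflector_shifted_mulVec {n : ℕ} (x : Fin (n + 1) → 𝕜) :
    reflector (shifted x) *ᵥ x = Pi.single 0 (-unitPhase (x 0) * (nrm x : 𝕜)) := by
  by_cases hx : x = 0
  · simp [hx, nrm_eq_zero.2]
  have hv : nrm (shifted x) ≠ 0 := by rwa [Ne, nrm_eq_zero, shifted_eq_zero]
  rw [reflector_mulVec, star_shifted_dotProduct, ← RCLike.ofReal_mul]
  have : 2 / nrm (shifted x) ^ 2 * (nrm x * (nrm x + ‖x 0‖)) = 1 := by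
    rw [div_mul_eq_mul_div, ← nrm_shifted_sq, div_self (pow_ne_zero _ hv)]
  rw [this, RCLike.ofReal_one, one_smul, shifted]
  ext i
  simp [Pi.single_apply]
  split_ifs <;> simp

lemma frame_mulVec_single {n : ℕ} (x : Fin (n + 1) → 𝕜) :
    frame x *ᵥ Pi.single 0 (nrm x : 𝕜) = x := by
  rw [frame, ← mulVec_mulVec, diagonal_mulVec_single, Fin.cons_zero, ← reflector_shifted_mulVec,
    mulVec_mulVec, reflector_mul_self, one_mulVec]

/-- The reflector contributes `-1` and the diagonal factor `-unitPhase (x 0)`. At `x = 0` the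
reflector degenerates to the identity and the sign is wrong. -/
lemma det_frame {n : ℕ} {x : Fin (n + 1) → 𝕜} (hx : x ≠ 0) :
    (frame x).det = unitPhase (x 0) := by
  rw [frame, det_mul, det_reflector (shifted_eq_zero.not.2 hx), det_diagonal_cons]
  ring

/-- Besides `x` itself, the construction uses only `‖x‖` and `x 0`, and `1 ⊕ V` preserves both. -/
lemma frame_conj {n : ℕ} {V : Matrix (Fin n) (Fin n) 𝕜} (hV : V ∈ unitaryGroup (Fin n) 𝕜)
    (x : Fin (n + 1) → 𝕜) :
    frame (bordered V *ᵥ x) = bordered V * frame x * star (bordered V) := by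
  have hW := bordered_mem_unitary hV
  have hs : shifted (bordered V *ᵥ x) = bordered V *ᵥ shifted x := by
    rw [shifted, shifted, nrm_mulVec hW, bordered_mulVec_zero, mulVec_add]
    congr 1
    ext i
    refine Fin.cases ?_ (fun i => ?_) i <;> simp
  rw [frame, frame, hs, reflector_conj hW, bordered_mulVec_zero, mul_assoc, ← bordered_star,
    ← diagonal_cons_mul_bordered, bordered_star]
  simp only [mul_assoc]

/-! ### Two-coordinate blocks and conjugation-invariant functions -/

/-- A unitary matrix acting on the first two coordinates, with first column proportional to
`(a, b, 0, …, 0)`. -/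
def block (n : ℕ) (a b : 𝕜) : Matrix (Fin (n + 2)) (Fin (n + 2)) 𝕜 :=
  frame (Fin.cons a (Pi.single 0 b))

/-- The Hessenberg matrix `G₁ ⋯ G_m diag(1, …, 1, d)` of prescribed determinant `ξ`, where `G_j` is
the block determined by `w j` in the rows and columns `j`, `j + 1`. -/
def hess : (m : ℕ) → 𝕜 → (Fin m → 𝕜 × 𝕜) → Matrix (Fin (m + 1)) (Fin (m + 1)) 𝕜
  | 0, ξ, _ => diagonal fun _ => ξ
  | m + 1, ξ, w => block m (w 0).1 (w 0).2 *
      bordered (hess m (ξ * star (unitPhase (w 0).1)) (Fin.tail w))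

lemma hess_mem_unitary (m : ℕ) {ξ : 𝕜} (hξ : ‖ξ‖ = 1) (w : Fin m → 𝕜 × 𝕜) :
    hess m ξ w ∈ unitaryGroup (Fin (m + 1)) 𝕜 := by
  induction m generalizing ξ with
  | zero => exact diagonal_mem_unitary fun _ => hξ
  | succ m ih =>
    refine mul_mem (frame_mem_unitary _) (bordered_mem_unitary (ih ?_ _))
    rw [norm_mul, norm_star, norm_unitPhase, hξ, one_mul]

lemma det_hess (m : ℕ) (ξ : 𝕜) {w : Fin m → 𝕜 × 𝕜} (hw : ∀ j, (w j).1 ≠ 0) :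
    (hess m ξ w).det = ξ := by
  induction m generalizing ξ with
  | zero => simp [hess]
  | succ m ih =>
    have h0 : (Fin.cons (w 0).1 (Pi.single 0 (w 0).2) : Fin (m + 2) → 𝕜) ≠ 0 := fun h =>
      hw 0 (by simpa using congrFun h 0)
    rw [hess, det_mul, det_bordered, ih _ (w := Fin.tail w) (fun j => hw j.succ), block, det_frame h0, Fin.cons_zero]
    linear_combination ξ * unitPhase_mul_star (w 0).1

lemma block_neg {n : ℕ} (a b : 𝕜) :
    block n a (-b) = bordered (-1) * block n a b * star (bordered (-1)) := by
  have : (-1 : Matrix (Fin (n + 1)) (Fin (n + 1)) 𝕜) ∈ unitaryGroup (Fin (n + 1)) 𝕜 := by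
    rw [mem_unitaryGroup_iff]; simp
  rw [block, block, ← frame_conj this, bordered_mulVec_cons, neg_mulVec, one_mulVec, Pi.single_neg]

/-- `1 ⊕ 1 ⊕ V` fixes the vector `(a, b, 0, …, 0)`, so by `frame_conj` conjugation by it fixes the
frame. -/
lemma block_comm {n : ℕ} {V : Matrix (Fin n) (Fin n) 𝕜} (hV : V ∈ unitaryGroup (Fin n) 𝕜)
    (a b : 𝕜) : bordered (bordered V) * block n a b = block n a b * bordered (bordered V) := by
  have h : bordered (bordered V) * block n a b * star (bordered (bordered V)) = block n a b := by
    rw [block, ← frame_conj (bordered_mem_unitary hV), bordered_mulVec_cons]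
    congr 2
    ext i
    refine Fin.cases ?_ (fun i => ?_) i <;> simp
  nth_rw 2 [← h]
  rw [mul_assoc, mem_unitaryGroup_iff'.1 (bordered_mem_unitary (bordered_mem_unitary hV)), mul_one]

/-- A function of matrices which is invariant under conjugation by `1 ⊕ V`, `V` unitary. -/
def ConjInvariant {n : ℕ} {γ : Type*} (f : Matrix (Fin (n + 1)) (Fin (n + 1)) 𝕜 → γ) : Prop :=
  ∀ V ∈ unitaryGroup (Fin n) 𝕜, ∀ A, f (bordered V * A * star (bordered V)) = f A

/-- The inductive step rests on this: after the first block is split off, the remaining function of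
the smaller matrix is of the same kind. -/
lemma ConjInvariant.block_bordered {n : ℕ} {γ : Type*}
    {f : Matrix (Fin (n + 2)) (Fin (n + 2)) 𝕜 → γ} (hf : ConjInvariant f) (a b : 𝕜) :
    ConjInvariant fun M => f (block n a b * bordered M) := by
  intro V hV A
  have h := hf _ (bordered_mem_unitary hV) (block n a b * bordered A)
  rw [← mul_assoc, block_comm hV] at h
  simpa only [bordered_mul, bordered_star, mul_assoc] using h

lemma ConjInvariant.block_neg {n : ℕ} {γ : Type*}
    {f : Matrix (Fin (n + 2)) (Fin (n + 2)) 𝕜 → γ} (hf : ConjInvariant f) (a b : 𝕜)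
    (M : Matrix (Fin (n + 1)) (Fin (n + 1)) 𝕜) :
    f (block n a (-b) * bordered M) = f (block n a b * bordered M) := by
  have hV : (-1 : Matrix (Fin (n + 1)) (Fin (n + 1)) 𝕜) ∈ unitaryGroup (Fin (n + 1)) 𝕜 := by
    rw [mem_unitaryGroup_iff]; simp
  rw [← hf _ hV (block n a b * bordered M)]
  congr 1
  rw [HaarHess.block_neg]
  simp only [← bordered_star, mul_assoc, ← bordered_mul]
  simp

/-- Only `β_j ^ 2` has a prescribed law, so the signs of the `β_j` are arbitrary. Conjugation by `1
⊕ (-1)` changes the sign in the first block and leaves the smaller matrix unchanged; the later signs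
follow recursively. -/
lemma ConjInvariant.hess_sign (m : ℕ) {γ : Type*}
    {f : Matrix (Fin (m + 1)) (Fin (m + 1)) 𝕜 → γ} (hf : ConjInvariant f) (ξ : 𝕜)
    {a b b' : Fin m → 𝕜} (hb : ∀ j, b' j = b j ∨ b' j = -b j) :
    f (hess m ξ fun j => (a j, b' j)) = f (hess m ξ fun j => (a j, b j)) := by
  induction m generalizing ξ with
  | zero => rfl
  | succ m ih =>
    simp only [hess]
    have h : f (block m (a 0) (b' 0) * bordered (hess m (ξ * star (unitPhase (a 0)))
          (Fin.tail fun j => (a j, b' j))))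
        = f (block m (a 0) (b 0) * bordered (hess m (ξ * star (unitPhase (a 0)))
          (Fin.tail fun j => (a j, b' j)))) := by
      rcases hb 0 with h | h <;> rw [h]
      exact hf.block_neg _ _ _
    rw [h]
    exact ih (hf.block_bordered _ _) (ξ * star (unitPhase (a 0))) (a := Fin.tail a)
      (b := Fin.tail b) (b' := Fin.tail b') fun j => hb j.succ

/-! ### The product of reflectors as a recursive Hessenberg matrix -/

/-- The reflecting vector vanishes beyond the first two coordinates. This is the source of the
Hessenberg shape. -/
lemma block_succ_succ {n : ℕ} (a b : 𝕜) (i : Fin n) :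
    block n a b i.succ.succ = (1 : Matrix (Fin (n + 2)) (Fin (n + 2)) 𝕜) i.succ.succ := by
  ext k
  have h : shifted (Fin.cons a (Pi.single 0 b) : Fin (n + 2) → 𝕜) i.succ.succ = 0 := by
    simp [shifted, Fin.succ_ne_zero]
  rw [block, frame, mul_diagonal, reflector]
  simp only [Matrix.sub_apply, Matrix.smul_apply, vecMulVec_apply, h, zero_mul, smul_zero, sub_zero]
  refine Fin.cases ?_ (fun k => ?_) k
  · simp [Fin.succ_ne_zero]
  · simp

lemma hess_apply_eq_zero (m : ℕ) (ξ : 𝕜) (w : Fin m → 𝕜 × 𝕜) (i j : Fin (m + 1))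
    (h : (j : ℕ) + 1 < i) : hess m ξ w i j = 0 := by
  induction m generalizing ξ with
  | zero => omega
  | succ m ih =>
    obtain ⟨i, rfl⟩ := Fin.exists_succ_eq.2 (show i ≠ 0 by rintro rfl; simp at h)
    obtain ⟨i, rfl⟩ := Fin.exists_succ_eq.2 (show i ≠ 0 by rintro rfl; simp at h)
    rw [hess, Matrix.mul_apply_eq_vecMul, block_succ_succ, ← Matrix.mul_apply_eq_vecMul, one_mul]
    revert h
    refine Fin.cases ?_ (fun j => ?_) j
    · simp
    · intro h
      rw [bordered_succ_succ]
      exact ih _ _ _ _ (by simpa using h)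

lemma phase_eq_unitPhase (z : ℂ) : phase z = unitPhase z := by
  unfold phase unitPhase
  split_ifs with h
  · simp [h]
  · have h' : (‖z‖ : ℂ) ≠ 0 := by simpa using h
    rw [eq_div_iff (by simpa using h), mul_comm]
    exact Complex.norm_mul_exp_arg_mul_I z

lemma reflector_cons_zero {n : ℕ} (v : Fin n → 𝕜) :
    reflector (Fin.cons 0 v : Fin (n + 1) → 𝕜) = bordered (reflector v) := by
  apply ext_fin_succ <;> intros <;>
    simp [reflector, vecMulVec_apply, Fin.sum_univ_succ, Matrix.one_apply, Fin.succ_ne_zero,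
      (Fin.succ_ne_zero _).symm]

lemma reflectorVector_zero {m : ℕ} (a b : ℂ) :
    reflectorVector (0 : Fin (m + 1)) a b = shifted (Fin.cons a (Pi.single 0 b)) := by
  have hn : nrm (Fin.cons a (Pi.single 0 b) : Fin (m + 2) → ℂ) = Real.sqrt (‖a‖ ^ 2 + ‖b‖ ^ 2) := by
    simp [nrm, Fin.sum_univ_succ]
  ext i
  refine Fin.cases ?_ (fun i => Fin.cases ?_ (fun i => ?_) i) i
  · simp [reflectorVector, shifted, hn, phase_eq_unitPhase]
  · simp [reflectorVector, shifted]
  · simp [reflectorVector, shifted, Fin.succ_ne_zero, Fin.succ_succ_ne_one]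

lemma reflectorVector_succ {m : ℕ} (j : Fin m) (a b : ℂ) :
    reflectorVector j.succ a b = Fin.cons 0 (reflectorVector j a b) := by
  ext i
  refine Fin.cases ?_ (fun i => ?_) i
  · simp [reflectorVector, (Fin.succ_ne_zero _).symm]
  · simp [reflectorVector]

lemma householder_eq_reflector {n : ℕ} (v : Fin n → ℂ) : householder v = reflector v := rfl

/-- The first diagonal entry commutes with all reflectors except the first, and together with that
one it forms the first block. -/
lemma hessenbergProduct_succ {m : ℕ} (a b : Fin (m + 1) → ℂ) (d : ℂ) :
    hessenbergProduct a b d =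
      block m (a 0) (b 0) * bordered (hessenbergProduct (Fin.tail a) (Fin.tail b) d) := by
  have hD : diagonal (Fin.snoc (α := fun _ => ℂ) (fun j : Fin (m + 1) => -phase (a j)) d) =
      diagonal (Fin.cons (-unitPhase (a 0)) 1) * bordered
        (diagonal (Fin.snoc (α := fun _ => ℂ) (fun j : Fin m => -phase (Fin.tail a j)) d)) := by
    rw [bordered_diagonal, diagonal_mul_diagonal]
    congr 1
    ext i
    refine Fin.cases ?_ (fun i => ?_) i
    · simp [Fin.snoc, phase_eq_unitPhase]
    · refine Fin.lastCases ?_ (fun i => ?_) i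
      · rw [Fin.succ_last]
        simp
      · rw [Fin.succ_castSucc, Fin.snoc_castSucc]
        simp [Fin.tail]
  rw [hessenbergProduct, hessenbergProduct, List.ofFn_succ, List.prod_cons, bordered_mul,
    bordered_prod, List.map_ofFn, hD, block, frame, householder_eq_reflector, reflectorVector_zero]
  have hl : (bordered ∘ fun j : Fin m => householder (reflectorVector j (Fin.tail a j) (Fin.tail b j)))
      = fun j : Fin m => householder (reflectorVector j.succ (a j.succ) (b j.succ)) := by
    ext1 j
    rw [reflectorVector_succ, householder_eq_reflector, reflector_cons_zero]
    rfl
  have hc : (List.ofFn fun j : Fin m =>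
      householder (reflectorVector j.succ (a j.succ) (b j.succ))).prod *
      diagonal (Fin.cons (-unitPhase (a 0)) 1) = diagonal (Fin.cons (-unitPhase (a 0)) 1) *
      (List.ofFn fun j : Fin m =>
      householder (reflectorVector j.succ (a j.succ) (b j.succ))).prod := by
    rw [← hl, ← List.map_ofFn, ← bordered_prod, diagonal_cons_mul_bordered]
  rw [hl, Fin.cons_zero]
  simp only [mul_assoc]
  congr 1
  rw [← mul_assoc, hc, mul_assoc]

/-- The parameter of `hess` plays the role of the determinant, and each block accounts for one
phase. The recursion divides these phases out again and leaves `d` in the last corner. -/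
lemma hessenbergProduct_eq_hess {m : ℕ} (a b : Fin m → ℂ) (d : ℂ) :
    hessenbergProduct a b d = hess m (d * ∏ j, unitPhase (a j)) fun j => (a j, b j) := by
  induction m with
  | zero =>
    simp only [hessenbergProduct, hess, List.ofFn_zero, List.prod_nil, one_mul]
    congr 1
    ext i
    fin_cases i
    simp [Fin.snoc]
  | succ m ih =>
    rw [hessenbergProduct_succ, hess, ih]
    have : d * (∏ j, unitPhase (a j)) * star (unitPhase (a 0)) =
        d * ∏ j, unitPhase (Fin.tail a j) := by
      rw [Fin.prod_univ_succ]
      simp only [Fin.tail]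
      linear_combination (d * ∏ j : Fin m, unitPhase (a j.succ)) * unitPhase_mul_star (a 0)
    rw [this]
    rfl

lemma norm_prod_unitPhase {m : ℕ} (a : Fin m → 𝕜) : ‖∏ j, unitPhase (a j)‖ = 1 := by
  rw [norm_prod]
  exact Finset.prod_eq_one fun j _ => norm_unitPhase _

lemma lastEntry_mul_prod {m : ℕ} (ξ : ℂ) (a : Fin m → ℂ) :
    lastEntry ξ a * ∏ j, unitPhase (a j) = ξ := by
  have h : ∏ j, star (-phase (a j)) = (-1) ^ m * star (∏ j, unitPhase (a j)) := by
    simp only [star_neg, phase_eq_unitPhase, star_prod]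
    rw [Finset.prod_neg]
    simp
  have h3 : star (∏ j, unitPhase (a j)) * ∏ j, unitPhase (a j) = 1 := by
    rw [RCLike.star_def, RCLike.conj_mul, norm_prod_unitPhase]
    simp
  have h4 : ((-1 : ℂ) ^ m) * (-1) ^ m = 1 := by rw [← mul_pow]; simp
  rw [lastEntry, h]
  linear_combination (ξ * ((-1 : ℂ) ^ m) * (-1) ^ m) * h3 + ξ * h4

lemma hessenbergProduct_lastEntry {m : ℕ} (ξ : ℂ) (a b : Fin m → ℂ) :
    hessenbergProduct a b (lastEntry ξ a) = hess m ξ fun j => (a j, b j) := by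
  rw [hessenbergProduct_eq_hess, lastEntry_mul_prod]

lemma isUpperHessenberg_hess (m : ℕ) (ξ : ℂ) (w : Fin m → ℂ × ℂ) :
    IsUpperHessenberg (hess m ξ w) := fun i j h => hess_apply_eq_zero m ξ w i j h

/-! ### Real matrices -/

lemma unitPhase_ofReal (x : ℝ) : unitPhase (x : ℂ) = ((unitPhase x : ℝ) : ℂ) := by
  unfold unitPhase
  split_ifs with h1 h2 h2
  · simp
  · exact absurd (by exact_mod_cast h1) h2
  · exact absurd (by exact_mod_cast h2) h1
  · simp

lemma nrm_ofReal {n : ℕ} (x : Fin n → ℝ) : nrm (fun i => (x i : ℂ)) = nrm x := by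
  simp [nrm]

lemma toComplex_mul {n : ℕ} (A B : Matrix (Fin n) (Fin n) ℝ) :
    toComplex (A * B) = toComplex A * toComplex B :=
  Matrix.map_mul (f := Complex.ofRealHom)

lemma toComplex_bordered {n : ℕ} (A : Matrix (Fin n) (Fin n) ℝ) :
    toComplex (bordered A) = bordered (toComplex A) := by
  apply ext_fin_succ <;> intros <;> simp [toComplex]

lemma toComplex_star {n : ℕ} (A : Matrix (Fin n) (Fin n) ℝ) :
    toComplex (star A) = star (toComplex A) := by
  ext i j
  simp [toComplex, Matrix.star_apply]

lemma toComplex_one {n : ℕ} : toComplex (1 : Matrix (Fin n) (Fin n) ℝ) = 1 := by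
  simp [toComplex]

lemma det_toComplex {n : ℕ} (A : Matrix (Fin n) (Fin n) ℝ) :
    (toComplex A).det = (A.det : ℂ) :=
  (RingHom.map_det Complex.ofRealHom A).symm

lemma toComplex_diagonal {n : ℕ} (d : Fin n → ℝ) :
    toComplex (diagonal d) = diagonal fun i => (d i : ℂ) := by
  simp [toComplex, Matrix.diagonal_map]

lemma toComplex_reflector {n : ℕ} (v : Fin n → ℝ) :
    toComplex (reflector v) = reflector fun i => (v i : ℂ) := by
  ext i j
  simp [toComplex, reflector, vecMulVec_apply, Matrix.one_apply]
  split_ifs <;> simp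

lemma toComplex_frame {n : ℕ} (x : Fin (n + 1) → ℝ) :
    toComplex (frame x) = frame fun i => (x i : ℂ) := by
  rw [frame, frame, toComplex_mul, toComplex_reflector, toComplex_diagonal]
  congr 2
  · ext i
    refine Fin.cases ?_ (fun i => ?_) i <;> simp [shifted, nrm_ofReal, unitPhase_ofReal]
  · ext i
    refine Fin.cases ?_ (fun i => ?_) i <;> simp [unitPhase_ofReal]

lemma toComplex_hess (m : ℕ) (ξ : ℝ) (w : Fin m → ℝ × ℝ) :
    toComplex (hess m ξ w) = hess m (ξ : ℂ) fun j => (((w j).1 : ℂ), ((w j).2 : ℂ)) := by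
  induction m generalizing ξ with
  | zero => simp [hess, toComplex_diagonal]
  | succ m ih =>
    rw [hess, hess, toComplex_mul, toComplex_bordered, ih, block, block, toComplex_frame]
    congr 2
    · ext i
      refine Fin.cases ?_ (fun i => Fin.cases ?_ (fun i => ?_) i) i <;> simp
    · congr 1
      simp [unitPhase_ofReal]

end linearAlgebra

section invariance

variable {𝕜 : Type*} [RCLike 𝕜] [MeasurableSpace 𝕜] [BorelSpace 𝕜]

/-! ### Measurability -/

lemma measurable_matrix_iff {α R : Type*} [MeasurableSpace α] [MeasurableSpace R] {m n : Type*}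
    {f : α → Matrix m n R} : Measurable f ↔ ∀ i j, Measurable fun x => f x i j := by
  exact ⟨fun h i j => measurable_pi_iff.1 (measurable_pi_iff.1 h i) j,
    fun h => measurable_pi_iff.2 fun i => measurable_pi_iff.2 (h i)⟩

section

variable {α : Type*} [MeasurableSpace α] {n : ℕ}

lemma _root_.Measurable.matrix_apply {f : α → Matrix (Fin n) (Fin n) 𝕜} (hf : Measurable f)
    (i j : Fin n) : Measurable fun x => f x i j := measurable_matrix_iff.1 hf i j

lemma _root_.Measurable.matrix_mul {f g : α → Matrix (Fin n) (Fin n) 𝕜} (hf : Measurable f)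
    (hg : Measurable g) : Measurable fun x => f x * g x := by
  refine measurable_matrix_iff.2 fun i j => ?_
  simp only [Matrix.mul_apply]
  exact Finset.measurable_sum _ fun k _ => (hf.matrix_apply i k).mul (hg.matrix_apply k j)

lemma _root_.Measurable.matrix_star {f : α → Matrix (Fin n) (Fin n) 𝕜} (hf : Measurable f) :
    Measurable fun x => star (f x) := by
  refine measurable_matrix_iff.2 fun i j => ?_
  simp only [Matrix.star_apply]
  exact RCLike.continuous_conj.measurable.comp (hf.matrix_apply j i)

lemma _root_.Measurable.matrix_bordered {f : α → Matrix (Fin n) (Fin n) 𝕜} (hf : Measurable f) :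
    Measurable fun x => bordered (f x) := by
  refine measurable_matrix_iff.2 fun i j => ?_
  refine Fin.cases (Fin.cases ?_ (fun j => ?_) j) (fun i => Fin.cases ?_ (fun j => ?_) j) i
  · simp
  · simp
  · simp
  · simpa using hf.matrix_apply i j

lemma _root_.Measurable.matrix_det {f : α → Matrix (Fin n) (Fin n) 𝕜} (hf : Measurable f) :
    Measurable fun x => (f x).det := by
  simp only [Matrix.det_apply]
  exact Finset.measurable_sum _ fun σ _ =>
    (Finset.measurable_prod _ fun i _ => hf.matrix_apply _ _).const_smul _

lemma _root_.Measurable.matrix_diagonal {f : α → Fin n → 𝕜} (hf : Measurable f) :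
    Measurable fun x => diagonal (f x) := by
  refine measurable_matrix_iff.2 fun i j => ?_
  simp only [Matrix.diagonal_apply]
  split_ifs
  · exact measurable_pi_iff.1 hf i
  · exact measurable_const

lemma _root_.Measurable.fin_cons {β : Type*} [MeasurableSpace β] {f : α → β} {g : α → Fin n → β}
    (hf : Measurable f) (hg : Measurable g) :
    Measurable fun x => (Fin.cons (f x) (g x) : Fin (n + 1) → β) := by
  refine measurable_pi_iff.2 fun i => ?_
  refine Fin.cases ?_ (fun i => ?_) i
  · simpa using hf
  · simpa using measurable_pi_iff.1 hg i

lemma measurable_fin_tail {β : Type*} [MeasurableSpace β] :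
    Measurable fun x : Fin (n + 1) → β => Fin.tail x :=
  measurable_pi_iff.2 fun i => measurable_pi_apply i.succ

lemma measurable_nrm : Measurable fun x : Fin n → 𝕜 => nrm x :=
  (Finset.measurable_sum _ fun i _ => (measurable_pi_apply i).norm.pow_const 2).sqrt

lemma measurable_nrm_coe : Measurable fun x : Fin n → 𝕜 => (nrm x : 𝕜) :=
  RCLike.continuous_ofReal.measurable.comp measurable_nrm

lemma measurable_unitPhase : Measurable fun z : 𝕜 => unitPhase z :=
  Measurable.ite (measurableSet_singleton 0) measurable_const
    (measurable_id.div (RCLike.continuous_ofReal.measurable.comp measurable_norm))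

lemma measurable_star_unitPhase : Measurable fun z : 𝕜 => star (unitPhase z) :=
  RCLike.continuous_conj.measurable.comp measurable_unitPhase

lemma measurable_frame : Measurable fun x : Fin (n + 1) → 𝕜 => frame x := by
  have hp : Measurable fun x : Fin (n + 1) → 𝕜 => unitPhase (x 0) :=
    measurable_unitPhase.comp (measurable_pi_apply 0)
  have hs : ∀ i, Measurable fun x : Fin (n + 1) → 𝕜 => shifted x i := by
    intro i
    simp only [shifted, Pi.add_apply, Pi.single_apply]
    refine (measurable_pi_apply i).add ?_
    split_ifs
    · exact hp.mul measurable_nrm_coe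
    · exact measurable_const
  refine Measurable.matrix_mul ?_ (Measurable.matrix_diagonal (hp.neg.fin_cons measurable_const))
  refine measurable_matrix_iff.2 fun i j => ?_
  simp only [reflector, Matrix.sub_apply, Matrix.smul_apply, vecMulVec_apply, Pi.star_apply,
    smul_eq_mul]
  refine measurable_const.sub (Measurable.mul ?_ ((hs i).mul ?_))
  · refine RCLike.continuous_ofReal.measurable.comp (measurable_const.div ?_)
    exact Finset.measurable_sum _ fun i _ => (hs i).norm.pow_const 2
  · exact RCLike.continuous_conj.measurable.comp (hs j)

lemma _root_.Measurable.block {f g : α → 𝕜} (hf : Measurable f) (hg : Measurable g) :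
    Measurable fun x => block n (f x) (g x) := by
  refine measurable_frame.comp (hf.fin_cons (measurable_pi_iff.2 fun i => ?_))
  simp only [Pi.single_apply]
  split_ifs
  · exact hg
  · exact measurable_const

lemma _root_.Measurable.hess (m : ℕ) {f : α → 𝕜} {g : α → Fin m → 𝕜 × 𝕜} (hf : Measurable f)
    (hg : Measurable g) : Measurable fun x => hess m (f x) (g x) := by
  induction m generalizing f with
  | zero => exact Measurable.matrix_diagonal (measurable_pi_iff.2 fun _ => hf)
  | succ m ih =>
    have h0 := measurable_pi_iff.1 hg 0
    refine (h0.fst.block h0.snd).matrix_mul (Measurable.matrix_bordered ?_)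
    exact ih (hf.mul (measurable_star_unitPhase.comp h0.fst)) (measurable_fin_tail.comp hg)

end

lemma measurableSet_unitary {n : ℕ} :
    MeasurableSet {A : Matrix (Fin n) (Fin n) 𝕜 | A ∈ unitaryGroup (Fin n) 𝕜} := by
  have : {A : Matrix (Fin n) (Fin n) 𝕜 | A ∈ unitaryGroup (Fin n) 𝕜} =
      ⋂ i, ⋂ j, {A | (A * star A) i j = (1 : Matrix (Fin n) (Fin n) 𝕜) i j} := by
    ext A
    simp [mem_unitaryGroup_iff, ← Matrix.ext_iff]
  rw [this]
  refine MeasurableSet.iInter fun i => MeasurableSet.iInter fun j => ?_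
  exact (measurable_id.matrix_mul measurable_id.matrix_star).matrix_apply i j
    (measurableSet_singleton _)

lemma measurableSet_unitary_det {n : ℕ} (ξ : 𝕜) : MeasurableSet {A : Matrix (Fin n) (Fin n) 𝕜 |
    A ∈ unitaryGroup (Fin n) 𝕜 ∧ A.det = ξ} :=
  measurableSet_unitary.inter (measurable_id.matrix_det (measurableSet_singleton _))

/-! ### Invariant measures on the cosets of the special unitary group -/

/-- A probability measure on the unitary matrices of determinant `ξ` which is invariant under
left multiplication by special unitary matrices. -/
structure IsCosetHaar {n : ℕ} (ξ : 𝕜) (ρ : Measure (Matrix (Fin n) (Fin n) 𝕜)) : Prop where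
  prob : IsProbabilityMeasure ρ
  ae_mem : ∀ᵐ A ∂ρ, A ∈ unitaryGroup (Fin n) 𝕜 ∧ A.det = ξ
  inv : ∀ s ∈ specialUnitaryGroup (Fin n) 𝕜, ρ.map (fun A => s * A) = ρ

lemma star_det_mul_det {n : ℕ} {A : Matrix (Fin n) (Fin n) 𝕜} (hA : A ∈ unitaryGroup (Fin n) 𝕜) :
    star A.det * A.det = 1 := by
  have := congrArg det (mem_unitaryGroup_iff'.1 hA)
  rwa [det_mul, det_one, star_eq_conjTranspose, det_conjTranspose] at this

lemma norm_det_unitary {n : ℕ} {A : Matrix (Fin n) (Fin n) 𝕜} (hA : A ∈ unitaryGroup (Fin n) 𝕜) :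
    ‖A.det‖ = 1 := by
  have h := congrArg norm (star_det_mul_det hA)
  rw [norm_mul, norm_star, norm_one] at h
  nlinarith [norm_nonneg A.det]

lemma mul_star_mem_special {n : ℕ} {A B : Matrix (Fin n) (Fin n) 𝕜}
    (hA : A ∈ unitaryGroup (Fin n) 𝕜) (hB : B ∈ unitaryGroup (Fin n) 𝕜) (h : A.det = B.det) :
    A * star B ∈ specialUnitaryGroup (Fin n) 𝕜 := by
  refine mem_specialUnitaryGroup_iff.2 ⟨mul_mem hA (Unitary.star_mem hB), ?_⟩
  rw [det_mul, star_eq_conjTranspose, det_conjTranspose, h, mul_comm, star_det_mul_det hB]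

lemma measurable_mul_left {n : ℕ} (s : Matrix (Fin n) (Fin n) 𝕜) : Measurable fun A => s * A :=
  measurable_const.matrix_mul measurable_id

lemma IsCosetHaar.lintegral_mul_left {n : ℕ} {ξ : 𝕜} {ρ : Measure (Matrix (Fin n) (Fin n) 𝕜)}
    (h : IsCosetHaar ξ ρ) {s : Matrix (Fin n) (Fin n) 𝕜} (hs : s ∈ specialUnitaryGroup (Fin n) 𝕜)
    {f : Matrix (Fin n) (Fin n) 𝕜 → ℝ≥0∞} (hf : Measurable f) :
    ∫⁻ A, f (s * A) ∂ρ = ∫⁻ A, f A ∂ρ := by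
  conv_rhs => rw [← h.inv s hs]
  rw [lintegral_map hf (measurable_mul_left s)]

/-- Uniqueness by Fubini: integrate `f (U y* z)` over both measures. For fixed `y`, the factor `U
y*` is special and `ρ` absorbs it; for fixed `z`, replacing `y` by `U z* y` removes `z`. The
resulting value no longer involves `ρ`. -/
lemma IsCosetHaar.lintegral_eq_aux {n : ℕ} {ξ : 𝕜} {ρ ρ' : Measure (Matrix (Fin n) (Fin n) 𝕜)}
    (h : IsCosetHaar ξ ρ) (h' : IsCosetHaar ξ ρ') {f : Matrix (Fin n) (Fin n) 𝕜 → ℝ≥0∞}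
    (hf : Measurable f) {U : Matrix (Fin n) (Fin n) 𝕜} (hU : U ∈ unitaryGroup (Fin n) 𝕜)
    (hdet : U.det = ξ) : ∫⁻ A, f A ∂ρ = ∫⁻ y, f (U * star y * U) ∂ρ' := by
  have := h.prob
  have := h'.prob
  have hm : Measurable (Function.uncurry fun y z : Matrix (Fin n) (Fin n) 𝕜 => f (U * star y * z)) :=
    hf.comp ((measurable_const.matrix_mul measurable_fst.matrix_star).matrix_mul measurable_snd)
  calc ∫⁻ A, f A ∂ρ = ∫⁻ y, ∫⁻ z, f (U * star y * z) ∂ρ ∂ρ' := by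
        have e : (fun y => ∫⁻ z, f (U * star y * z) ∂ρ) =ᵐ[ρ'] fun _ => ∫⁻ A, f A ∂ρ := by
          filter_upwards [h'.ae_mem] with y hy
          exact h.lintegral_mul_left (mul_star_mem_special hU hy.1 (hdet.trans hy.2.symm)) hf
        rw [lintegral_congr_ae e]
        simp
    _ = ∫⁻ z, ∫⁻ y, f (U * star y * z) ∂ρ' ∂ρ := lintegral_lintegral_swap hm.aemeasurable
    _ = ∫⁻ y, f (U * star y * U) ∂ρ' := by
        have e : (fun z => ∫⁻ y, f (U * star y * z) ∂ρ') =ᵐ[ρ]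
            fun _ => ∫⁻ y, f (U * star y * U) ∂ρ' := by
          filter_upwards [h.ae_mem] with z hz
          rw [← h'.lintegral_mul_left (mul_star_mem_special hU hz.1 (hdet.trans hz.2.symm))
            (f := fun y => f (U * star y * U))
            (hf.comp ((measurable_const.matrix_mul measurable_id.matrix_star).matrix_mul
              measurable_const))]
          refine lintegral_congr fun y => ?_
          congr 1
          rw [star_mul, star_mul, star_star]
          simp only [mul_assoc]
          rw [mem_unitaryGroup_iff'.1 hU, mul_one]
        rw [lintegral_congr_ae e]
        simp

lemma IsCosetHaar.lintegral_eq {n : ℕ} {ξ : 𝕜} {ρ ρ' : Measure (Matrix (Fin n) (Fin n) 𝕜)}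
    (h : IsCosetHaar ξ ρ) (h' : IsCosetHaar ξ ρ') {f : Matrix (Fin n) (Fin n) 𝕜 → ℝ≥0∞}
    (hf : Measurable f) : ∫⁻ A, f A ∂ρ = ∫⁻ A, f A ∂ρ' := by
  have := h.prob
  obtain ⟨U, hU, hdet⟩ := h.ae_mem.exists
  rw [h.lintegral_eq_aux h' hf hU hdet, h'.lintegral_eq_aux h' hf hU hdet]

/-- A left factor `s` passes through `B` as `B* s B`, which is again special, while `T` on the right
does not interfere. -/
lemma IsCosetHaar.map_mul_mul {n : ℕ} {ξ : 𝕜} {ρ : Measure (Matrix (Fin n) (Fin n) 𝕜)}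
    (h : IsCosetHaar ξ ρ) {B T : Matrix (Fin n) (Fin n) 𝕜} (hB : B ∈ unitaryGroup (Fin n) 𝕜)
    (hT : T ∈ unitaryGroup (Fin n) 𝕜) :
    IsCosetHaar (B.det * ξ * T.det) (ρ.map fun A => B * A * T) := by
  have := h.prob
  have hm : Measurable fun A : Matrix (Fin n) (Fin n) 𝕜 => B * A * T :=
    (measurable_mul_left B).matrix_mul measurable_const
  refine ⟨Measure.isProbabilityMeasure_map hm.aemeasurable, ?_, fun s hs => ?_⟩
  · rw [ae_map_iff hm.aemeasurable (measurableSet_unitary_det _)]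
    filter_upwards [h.ae_mem] with A hA
    exact ⟨mul_mem (mul_mem hB hA.1) hT, by rw [det_mul, det_mul, hA.2]⟩
  · have hs' : star B * s * B ∈ specialUnitaryGroup (Fin n) 𝕜 := by
      rw [mem_specialUnitaryGroup_iff] at hs ⊢
      refine ⟨mul_mem (mul_mem (Unitary.star_mem hB) hs.1) hB, ?_⟩
      rw [det_mul, det_mul, hs.2, mul_one, star_eq_conjTranspose, det_conjTranspose,
        star_det_mul_det hB]
    conv_rhs => rw [← h.inv _ hs', Measure.map_map hm (measurable_mul_left _)]
    rw [Measure.map_map (measurable_mul_left _) hm]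
    congr 1
    ext1 A
    simp only [Function.comp_apply, ← mul_assoc]
    rw [mem_unitaryGroup_iff.1 hB, one_mul]

/-! ### The Gaussian input and the recursive construction -/

/-- A law without atom at `0` whose finite powers are invariant under unitary matrices. -/
structure IsIsotropic (γ : Measure 𝕜) : Prop where
  prob : IsProbabilityMeasure γ
  zero : γ {0} = 0
  inv : ∀ (n : ℕ), ∀ U ∈ unitaryGroup (Fin n) 𝕜,
    (Measure.pi fun _ : Fin n => γ).map (fun x => U *ᵥ x) = Measure.pi fun _ : Fin n => γ

/-- The law of the Euclidean norm of `k` independent variables of law `γ`. -/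
def chiLaw (γ : Measure 𝕜) (k : ℕ) : Measure 𝕜 :=
  (Measure.pi fun _ : Fin k => γ).map fun x => (nrm x : 𝕜)

/-- The law of independent `(α_j, β_j)` with independent components, of laws `γ` and
`chiLaw γ (m - j)`. -/
def inputLaw (γ : Measure 𝕜) (m : ℕ) : Measure (Fin m → 𝕜 × 𝕜) :=
  Measure.pi fun j : Fin m => γ.prod (chiLaw γ (m - j))

instance isProbabilityMeasure_chiLaw (γ : Measure 𝕜) [IsProbabilityMeasure γ] (k : ℕ) :
    IsProbabilityMeasure (chiLaw γ k) :=
  Measure.isProbabilityMeasure_map measurable_nrm_coe.aemeasurable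

instance isProbabilityMeasure_inputLaw (γ : Measure 𝕜) [IsProbabilityMeasure γ] (m : ℕ) :
    IsProbabilityMeasure (inputLaw γ m) := by
  unfold inputLaw; infer_instance

lemma lintegral_pi_fin_succ {β : Type*} [MeasurableSpace β] {n : ℕ} (μ : Fin (n + 1) → Measure β)
    [∀ i, IsProbabilityMeasure (μ i)] {g : (Fin (n + 1) → β) → ℝ≥0∞} (hg : Measurable g) :
    ∫⁻ x, g x ∂Measure.pi μ =
      ∫⁻ a, ∫⁻ x, g (Fin.cons a x) ∂(Measure.pi fun i : Fin n => μ i.succ) ∂μ 0 := by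
  have hm : Measurable fun p : β × (Fin n → β) => g (Fin.cons p.1 p.2) :=
    hg.comp (measurable_fst.fin_cons measurable_snd)
  have h := measurePreserving_piFinSuccAbove μ 0
  have h2 := h.lintegral_comp hm
  rw [lintegral_prod _ hm.aemeasurable] at h2
  simp only [Fin.zero_succAbove] at h2
  rw [← h2]
  refine lintegral_congr fun x => ?_
  congr 1
  ext i
  refine Fin.cases ?_ (fun i => ?_) i <;> rfl

/-- The first input pair is read off from an isotropic vector as its first coordinate and the norm
of its tail, of length `m + 1`. For the other pairs, the degrees of freedom agree because `(m + 1) -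
(i + 1) = m - i`. -/
lemma lintegral_inputLaw_succ (γ : Measure 𝕜) [IsProbabilityMeasure γ] (m : ℕ)
    {g : (Fin (m + 1) → 𝕜 × 𝕜) → ℝ≥0∞} (hg : Measurable g) :
    ∫⁻ w, g w ∂inputLaw γ (m + 1) =
      ∫⁻ x, ∫⁻ w, g (Fin.cons (x 0, (nrm (Fin.tail x) : 𝕜)) w) ∂inputLaw γ m
        ∂(Measure.pi fun _ : Fin (m + 2) => γ) := by
  have hm1 : Measurable fun p : 𝕜 × 𝕜 => ∫⁻ w, g (Fin.cons p w) ∂inputLaw γ m :=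
    Measurable.lintegral_prod_right' (f := fun q : (𝕜 × 𝕜) × (Fin m → 𝕜 × 𝕜) => g (Fin.cons q.1 q.2))
      (hg.comp (measurable_fst.fin_cons measurable_snd))
  have hm2 : Measurable fun x : Fin (m + 2) → 𝕜 =>
      ∫⁻ w, g (Fin.cons (x 0, (nrm (Fin.tail x) : 𝕜)) w) ∂inputLaw γ m :=
    hm1.comp ((measurable_pi_apply 0).prodMk (measurable_nrm_coe.comp measurable_fin_tail))
  rw [lintegral_pi_fin_succ _ hm2, inputLaw, lintegral_pi_fin_succ _ hg]
  have hsucc : (Measure.pi fun i : Fin m => γ.prod (chiLaw γ (m + 1 - (i.succ : Fin (m + 1)))))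
      = inputLaw γ m := by
    unfold inputLaw
    congr 1
    ext1 i
    simp
  rw [hsucc, lintegral_prod _ hm1.aemeasurable]
  refine lintegral_congr fun a => ?_
  rw [chiLaw, lintegral_map (f := fun y => ∫⁻ w, g (Fin.cons (a, y) w) ∂inputLaw γ m)
    (hm1.comp measurable_prodMk_left) measurable_nrm_coe]
  rfl

/-! ### Unitary matrices with a prescribed first column, and the recursive Haar measure -/

lemma eq_bordered_of_mulVec {n : ℕ} {A : Matrix (Fin (n + 1)) (Fin (n + 1)) 𝕜}
    (hA : A ∈ unitaryGroup (Fin (n + 1)) 𝕜) (h : A *ᵥ Pi.single 0 1 = Pi.single 0 1) :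
    ∃ S ∈ unitaryGroup (Fin n) 𝕜, A = bordered S := by
  have h' : star A *ᵥ Pi.single 0 1 = Pi.single 0 1 := by
    nth_rw 1 [← h]
    rw [mulVec_mulVec, mem_unitaryGroup_iff'.1 hA, one_mulVec]
  have hcol : ∀ i, A i 0 = (Pi.single 0 1 : Fin (n + 1) → 𝕜) i := fun i => by
    rw [← h]; simp
  have hrow : ∀ i, A 0 i = (Pi.single 0 1 : Fin (n + 1) → 𝕜) i := fun i => by
    have := congrFun h' i
    simp only [mulVec_single_one, Matrix.col_apply, Matrix.star_apply] at this
    rw [← star_star (A 0 i), this]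
    by_cases hi : i = 0
    · subst hi; simp
    · simp [hi]
  have hAS : A = bordered (A.submatrix Fin.succ Fin.succ) := by
    apply ext_fin_succ <;> intros <;> simp [hcol, hrow]
  refine ⟨A.submatrix Fin.succ Fin.succ, ?_, hAS⟩
  have := mem_unitaryGroup_iff.1 hA
  rw [hAS, ← bordered_star, ← bordered_mul] at this
  rw [mem_unitaryGroup_iff]
  ext i j
  have hij := congrFun (congrFun this i.succ) j.succ
  rw [bordered_succ_succ] at hij
  rw [hij]
  simp [Matrix.one_apply]

/-- A unitary matrix with first column `x / ‖x‖`, adapted to the reduction to Hessenberg form. -/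
def hessFrame {m : ℕ} (x : Fin (m + 2) → 𝕜) : Matrix (Fin (m + 2)) (Fin (m + 2)) 𝕜 :=
  bordered (frame (Fin.tail x)) * block m (x 0) (nrm (Fin.tail x) : 𝕜)

section hessFrame

variable {m : ℕ}

lemma measurable_hessFrame : Measurable fun x : Fin (m + 2) → 𝕜 => hessFrame x :=
  (measurable_frame.comp measurable_fin_tail).matrix_bordered.matrix_mul
    ((measurable_pi_apply 0).block (measurable_nrm_coe.comp measurable_fin_tail))

lemma hessFrame_mem_unitary (x : Fin (m + 2) → 𝕜) :
    hessFrame x ∈ unitaryGroup (Fin (m + 2)) 𝕜 :=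
  mul_mem (bordered_mem_unitary (frame_mem_unitary _)) (frame_mem_unitary _)

lemma hessFrame_mulVec_single (x : Fin (m + 2) → 𝕜) :
    hessFrame x *ᵥ Pi.single 0 (nrm x : 𝕜) = x := by
  have h : nrm x = nrm (Fin.cons (x 0) (Pi.single 0 (nrm (Fin.tail x) : 𝕜)) : Fin (m + 2) → 𝕜) := by
    have h1 : ∑ i : Fin (m + 1), ‖(Pi.single 0 (nrm (Fin.tail x) : 𝕜) : Fin (m + 1) → 𝕜) i‖ ^ 2 =
        ∑ i : Fin (m + 1), ‖x i.succ‖ ^ 2 := by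
      rw [Fin.sum_univ_succ]
      simp [nrm_sq, Fin.tail]
    have h2 : ∀ y : Fin (m + 2) → 𝕜, nrm y = Real.sqrt (‖y 0‖ ^ 2 + ∑ i : Fin (m + 1), ‖y i.succ‖ ^ 2) :=
      fun y => by rw [nrm, Fin.sum_univ_succ]
    rw [h2, h2]
    simp only [Fin.cons_zero, Fin.cons_succ, h1]
  rw [hessFrame, ← mulVec_mulVec, block, h, frame_mulVec_single, bordered_mulVec_cons,
    frame_mulVec_single]
  exact Fin.cons_self_tail x

/-- Both `s V(x)` and `V(s x)` have first column `s x / ‖x‖`, so their quotient fixes the first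
basis vector. For `x = 0` the first column is not determined. -/
lemma exists_mul_hessFrame {s : Matrix (Fin (m + 2)) (Fin (m + 2)) 𝕜}
    (hs : s ∈ unitaryGroup (Fin (m + 2)) 𝕜) {x : Fin (m + 2) → 𝕜} (hx : x ≠ 0) :
    ∃ S ∈ unitaryGroup (Fin (m + 1)) 𝕜, s * hessFrame x = hessFrame (s *ᵥ x) * bordered S := by
  have hV := hessFrame_mem_unitary (s *ᵥ x)
  obtain ⟨S, hS, h⟩ := eq_bordered_of_mulVec
    (mul_mem (Unitary.star_mem hV) (mul_mem hs (hessFrame_mem_unitary x))) (by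
    have hr : (nrm x : 𝕜) ≠ 0 := by simpa using (nrm_eq_zero (x := x)).not.2 hx
    have h1 : (Pi.single 0 1 : Fin (m + 2) → 𝕜) = (nrm x : 𝕜)⁻¹ • Pi.single 0 (nrm x : 𝕜) := by
      rw [← Pi.single_smul, smul_eq_mul, inv_mul_cancel₀ hr]
    have h2 : (star (hessFrame (s *ᵥ x)) * (s * hessFrame x)) *ᵥ Pi.single 0 (nrm x : 𝕜) =
        Pi.single 0 (nrm x : 𝕜) := by
      rw [← mulVec_mulVec, ← mulVec_mulVec, hessFrame_mulVec_single]
      nth_rw 2 [← hessFrame_mulVec_single (s *ᵥ x)]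
      rw [mulVec_mulVec, mem_unitaryGroup_iff'.1 hV, one_mulVec, nrm_mulVec hs]
    rw [h1, mulVec_smul, h2])
  refine ⟨S, hS, ?_⟩
  rw [← h, ← mul_assoc, mem_unitaryGroup_iff.1 hV, one_mul]

lemma det_hessFrame {x : Fin (m + 2) → 𝕜} (hx : x 0 ≠ 0) :
    (hessFrame x).det = (frame (Fin.tail x)).det * unitPhase (x 0) := by
  have h0 : (Fin.cons (x 0) (Pi.single 0 (nrm (Fin.tail x) : 𝕜)) : Fin (m + 2) → 𝕜) ≠ 0 := fun h =>
    hx (by simpa using congrFun h 0)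
  rw [hessFrame, det_mul, det_bordered, block, det_frame h0, Fin.cons_zero]

/-- The diagonal factor which corrects the determinant to `ξ`. -/
def corrector (ξ : 𝕜) (x : Fin (m + 2) → 𝕜) : Matrix (Fin (m + 1)) (Fin (m + 1)) 𝕜 :=
  diagonal (Fin.cons (ξ * star (hessFrame x).det) 1)

lemma measurable_corrector (ξ : 𝕜) : Measurable fun x : Fin (m + 2) → 𝕜 => corrector ξ x :=
  Measurable.matrix_diagonal ((measurable_const.mul
    (RCLike.continuous_conj.measurable.comp measurable_hessFrame.matrix_det)).fin_cons
      measurable_const)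

lemma det_corrector (ξ : 𝕜) (x : Fin (m + 2) → 𝕜) :
    (corrector ξ x).det = ξ * star (hessFrame x).det := det_diagonal_cons _

lemma corrector_mem_unitary {ξ : 𝕜} (hξ : ‖ξ‖ = 1) (x : Fin (m + 2) → 𝕜) :
    corrector ξ x ∈ unitaryGroup (Fin (m + 1)) 𝕜 :=
  diagonal_cons_mem_unitary (by
    rw [norm_mul, norm_star, hξ, norm_det_unitary (hessFrame_mem_unitary x), one_mul])

end hessFrame

/-- The law of `V(X) (1 ⊕ D(X) y)`, where `X` is isotropic, `V(X)` has first column `X / ‖X‖`, and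
`y` has law `ρ`. -/
def extendedLaw {m : ℕ} (γ : Measure 𝕜) (ξ : 𝕜) (ρ : Measure (Matrix (Fin (m + 1)) (Fin (m + 1)) 𝕜)) :
    Measure (Matrix (Fin (m + 2)) (Fin (m + 2)) 𝕜) :=
  ((Measure.pi fun _ : Fin (m + 2) => γ).prod ρ).map fun p =>
    hessFrame p.1 * bordered (corrector ξ p.1 * p.2)

section extendedLaw

variable {m : ℕ} {γ : Measure 𝕜} {ξ : 𝕜} {ρ : Measure (Matrix (Fin (m + 1)) (Fin (m + 1)) 𝕜)}

lemma measurable_extension : Measurable fun p : (Fin (m + 2) → 𝕜) × Matrix (Fin (m + 1)) (Fin (m + 1)) 𝕜 =>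
    hessFrame p.1 * bordered (corrector ξ p.1 * p.2) :=
  (measurable_hessFrame.comp measurable_fst).matrix_mul
    (((measurable_corrector ξ).comp measurable_fst).matrix_mul measurable_snd).matrix_bordered

lemma lintegral_extendedLaw [IsProbabilityMeasure γ] [IsProbabilityMeasure ρ]
    {f : Matrix (Fin (m + 2)) (Fin (m + 2)) 𝕜 → ℝ≥0∞} (hf : Measurable f) :
    ∫⁻ A, f A ∂extendedLaw γ ξ ρ = ∫⁻ x, ∫⁻ y, f (hessFrame x * bordered (corrector ξ x * y)) ∂ρ
      ∂(Measure.pi fun _ : Fin (m + 2) => γ) := by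
  rw [extendedLaw, lintegral_map hf measurable_extension,
    lintegral_prod (fun p : (Fin (m + 2) → 𝕜) × Matrix (Fin (m + 1)) (Fin (m + 1)) 𝕜 =>
      f (hessFrame p.1 * bordered (corrector ξ p.1 * p.2)))
      (hf.comp measurable_extension).aemeasurable]

lemma ae_apply_zero_ne_zero (hγ : IsIsotropic γ) (n : ℕ) :
    ∀ᵐ x ∂(Measure.pi fun _ : Fin (n + 1) => γ), x 0 ≠ 0 := by
  have := hγ.prob
  have h : ∀ᵐ a ∂γ, a ≠ 0 := by
    rw [ae_iff]
    simpa using hγ.zero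
  exact (measurePreserving_eval (fun _ : Fin (n + 1) => γ) 0).quasiMeasurePreserving.ae h

lemma isCosetHaar_extendedLaw (hγ : IsIsotropic γ) (hξ : ‖ξ‖ = 1) (hρ : IsCosetHaar 1 ρ) :
    IsCosetHaar ξ (extendedLaw γ ξ ρ) := by
  have := hγ.prob
  have := hρ.prob
  have hξ' : star ξ * ξ = 1 := by rw [RCLike.star_def, RCLike.conj_mul, hξ]; simp
  refine ⟨Measure.isProbabilityMeasure_map measurable_extension.aemeasurable, ?_, fun s hs => ?_⟩
  · rw [extendedLaw, ae_map_iff measurable_extension.aemeasurable (measurableSet_unitary_det ξ)]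
    have h2 := (Measure.quasiMeasurePreserving_snd
      (μ := Measure.pi fun _ : Fin (m + 2) => γ) (ν := ρ)).ae hρ.ae_mem
    filter_upwards [h2] with p hp
    refine ⟨mul_mem (hessFrame_mem_unitary _) (bordered_mem_unitary
      (mul_mem (corrector_mem_unitary hξ _) hp.1)), ?_⟩
    rw [det_mul, det_bordered, det_mul, hp.2, det_corrector]
    linear_combination ξ * star_det_mul_det (hessFrame_mem_unitary p.1)
  · have hsU := (mem_specialUnitaryGroup_iff.1 hs).1
    have hsd := (mem_specialUnitaryGroup_iff.1 hs).2
    refine Measure.ext_of_lintegral _ fun f hf => ?_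
    have hfs : Measurable fun A => f (s * A) := hf.comp (measurable_mul_left s)
    rw [lintegral_map hf (measurable_mul_left s), lintegral_extendedLaw hfs,
      lintegral_extendedLaw hf]
    have hF : Measurable fun x => ∫⁻ y, f (hessFrame x * bordered (corrector ξ x * y)) ∂ρ :=
      Measurable.lintegral_prod_right' (f := fun p : (Fin (m + 2) → 𝕜) ×
        Matrix (Fin (m + 1)) (Fin (m + 1)) 𝕜 => f (hessFrame p.1 * bordered (corrector ξ p.1 * p.2)))
        (hf.comp measurable_extension)
    have hmv : Measurable fun x : Fin (m + 2) → 𝕜 => s *ᵥ x := by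
      refine measurable_pi_iff.2 fun i => ?_
      simp only [mulVec, dotProduct]
      exact Finset.measurable_sum _ fun j _ => measurable_const.mul (measurable_pi_apply j)
    -- Isotropy replaces `x` by `s x` on the right, so that both sides involve the same outer frame
    -- and can be compared pointwise in `x`.
    conv_rhs => rw [← hγ.inv _ s hsU, lintegral_map hF hmv]
    refine lintegral_congr_ae ?_
    filter_upwards [ae_apply_zero_ne_zero hγ (m + 1)] with x hx
    have hx0 : x ≠ 0 := fun h => hx (by simp [h])
    obtain ⟨S, hS, hV⟩ := exists_mul_hessFrame hsU hx0
    have hD := corrector_mem_unitary hξ (s *ᵥ x)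
    have hdet : (corrector ξ (s *ᵥ x)).det = (S * corrector ξ x).det := by
      have h1 := congrArg det hV
      rw [det_mul, det_mul, det_bordered, hsd, one_mul] at h1
      rw [det_mul, det_corrector, det_corrector, h1, star_mul]
      linear_combination -ξ * star (hessFrame (s *ᵥ x)).det * star_det_mul_det hS
    -- The mismatch `S` and the two correctors combine into one matrix of determinant `1`, which the
    -- invariance of `ρ` absorbs.
    have hR : star (corrector ξ (s *ᵥ x)) * (S * corrector ξ x) ∈
        specialUnitaryGroup (Fin (m + 1)) 𝕜 := by
      refine mem_specialUnitaryGroup_iff.2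
        ⟨mul_mem (Unitary.star_mem hD) (mul_mem hS (corrector_mem_unitary hξ x)), ?_⟩
      rw [det_mul, ← hdet, star_eq_conjTranspose, det_conjTranspose, star_det_mul_det hD]
    have hg : Measurable fun y => f (hessFrame (s *ᵥ x) * bordered (corrector ξ (s *ᵥ x) * y)) :=
      hf.comp (measurable_const.matrix_mul (measurable_mul_left _).matrix_bordered)
    change ∫⁻ y, f (s * (hessFrame x * bordered (corrector ξ x * y))) ∂ρ = _
    rw [← hρ.lintegral_mul_left hR hg]
    refine lintegral_congr fun y => ?_
    congr 1
    rw [← mul_assoc, hV, mul_assoc, ← bordered_mul]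
    simp only [← mul_assoc]
    rw [mem_unitaryGroup_iff.1 hD, one_mul]

end extendedLaw

/-- The invariant probability measure on the unitary matrices of determinant `ξ` and the random
Hessenberg matrix of determinant `ξ` give the same mean to functions which are invariant under
conjugation by the unitary matrices fixing the first basis vector. -/
theorem exists_isCosetHaar_lintegral_eq {γ : Measure 𝕜} (hγ : IsIsotropic γ) (m : ℕ) {ξ : 𝕜}
    (hξ : ‖ξ‖ = 1) : ∃ ρ : Measure (Matrix (Fin (m + 1)) (Fin (m + 1)) 𝕜), IsCosetHaar ξ ρ ∧
      ∀ f : Matrix (Fin (m + 1)) (Fin (m + 1)) 𝕜 → ℝ≥0∞, Measurable f → ConjInvariant f →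
        ∫⁻ A, f A ∂ρ = ∫⁻ w, f (hess m ξ w) ∂inputLaw γ m := by
  have := hγ.prob
  induction m generalizing ξ with
  | zero =>
    refine ⟨Measure.dirac (diagonal fun _ => ξ), ⟨inferInstance, ?_, fun s hs => ?_⟩, ?_⟩
    · rw [ae_dirac_iff (measurableSet_unitary_det ξ)]
      exact ⟨diagonal_mem_unitary fun _ => hξ, by simp⟩
    · have : s = 1 := by
        have h := (mem_specialUnitaryGroup_iff.1 hs).2
        rw [show s.det = s 0 0 from det_fin_one s] at h
        ext i j
        fin_cases i; fin_cases j
        simpa using h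
      simp [this]
    · intro f hf _
      rw [lintegral_dirac' _ hf]
      simp [hess]
  | succ m ih =>
    -- Only the existence of the smaller Haar measure is used here; its integral formula is used
    -- below, at the determinant `η` attached to `x`.
    obtain ⟨ρ, hρ, -⟩ := ih (ξ := 1) (by simp)
    have := hρ.prob
    refine ⟨extendedLaw γ ξ ρ, isCosetHaar_extendedLaw hγ hξ hρ, fun f hf hinv => ?_⟩
    have hhess : Measurable fun w : Fin (m + 1) → 𝕜 × 𝕜 => hess (m + 1) ξ w :=
      Measurable.hess (m + 1) measurable_const measurable_id
    rw [lintegral_extendedLaw hf, lintegral_inputLaw_succ γ m (g := fun w => f (hess (m + 1) ξ w))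
      (hf.comp hhess)]
    refine lintegral_congr_ae ?_
    filter_upwards [ae_apply_zero_ne_zero hγ (m + 1)] with x hx
    set η : 𝕜 := ξ * star (unitPhase (x 0)) with hη
    have hηn : ‖η‖ = 1 := by rw [hη, norm_mul, norm_star, norm_unitPhase, hξ, one_mul]
    obtain ⟨ρη, hρη, hint⟩ := ih hηn
    set T := frame (Fin.tail x)
    have hT : T ∈ unitaryGroup (Fin (m + 1)) 𝕜 := frame_mem_unitary _
    set B : Matrix (Fin (m + 2)) (Fin (m + 2)) 𝕜 := block m (x 0) (nrm (Fin.tail x) : 𝕜) with hB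
    have hmap := hρ.map_mul_mul (corrector_mem_unitary hξ x) hT
    -- The determinant of `T` cancels: it occurs conjugated in the corrector, through `det V(x) =
    -- det T · unitPhase (x 0)`.
    have hdet : (corrector ξ x).det * 1 * T.det = η := by
      rw [det_corrector, det_hessFrame hx, star_mul]
      linear_combination (ξ * star (unitPhase (x 0))) * star_det_mul_det hT
    rw [hdet] at hmap
    have hg : Measurable fun M => f (B * bordered M) :=
      hf.comp (measurable_const.matrix_mul measurable_id.matrix_bordered)
    have hm : Measurable fun A => corrector ξ x * A * T :=
      (measurable_mul_left _).matrix_mul measurable_const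
    calc ∫⁻ y, f (hessFrame x * bordered (corrector ξ x * y)) ∂ρ
        = ∫⁻ y, f (B * bordered (corrector ξ x * y * T)) ∂ρ := by
          refine lintegral_congr fun y => ?_
          -- Conjugation by `1 ⊕ T*` strips `1 ⊕ T` from the left of `V(x)` and moves it into the
          -- smaller matrix, on the right.
          rw [← hinv _ (Unitary.star_mem hT)]
          congr 1
          rw [hessFrame, bordered_star, star_star, ← mul_assoc, ← mul_assoc, ← bordered_star,
            ← bordered_mul, mem_unitaryGroup_iff'.1 hT, bordered_one, one_mul, mul_assoc,
            ← bordered_mul]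
      _ = ∫⁻ M, f (B * bordered M) ∂(ρ.map fun A => corrector ξ x * A * T) :=
          (lintegral_map hg hm).symm
      _ = ∫⁻ M, f (B * bordered M) ∂ρη := hmap.lintegral_eq hρη hg
      _ = ∫⁻ w, f (B * bordered (hess m η w)) ∂inputLaw γ m :=
          hint _ hg (hinv.block_bordered _ _)
      _ = _ := rfl

lemma IsCosetHaar.lintegral_eq_hess {γ : Measure 𝕜} (hγ : IsIsotropic γ) {m : ℕ} {ξ : 𝕜}
    (hξ : ‖ξ‖ = 1) {ρ : Measure (Matrix (Fin (m + 1)) (Fin (m + 1)) 𝕜)} (hρ : IsCosetHaar ξ ρ)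
    {f : Matrix (Fin (m + 1)) (Fin (m + 1)) 𝕜 → ℝ≥0∞} (hf : Measurable f) (hinv : ConjInvariant f) :
    ∫⁻ A, f A ∂ρ = ∫⁻ w, f (hess m ξ w) ∂inputLaw γ m := by
  obtain ⟨ρ', hρ', h⟩ := exists_isCosetHaar_lintegral_eq hγ m hξ
  rw [hρ.lintegral_eq hρ' hf, h f hf hinv]

/-! ### From fixed determinant to the full group -/

/-- A law on the unit scalars which is invariant under multiplication by unit scalars. -/
structure IsUniformPhase (μ : Measure 𝕜) : Prop where
  prob : IsProbabilityMeasure μ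
  ae_norm : ∀ᵐ z ∂μ, ‖z‖ = 1
  inv : ∀ u : 𝕜, ‖u‖ = 1 → μ.map (fun z => u * z) = μ

lemma IsUniformPhase.lintegral_mul_left {μ : Measure 𝕜} (hμ : IsUniformPhase μ) {u : 𝕜}
    (hu : ‖u‖ = 1) {F : 𝕜 → ℝ≥0∞} (hF : Measurable F) : ∫⁻ z, F (u * z) ∂μ = ∫⁻ z, F z ∂μ := by
  conv_rhs => rw [← hμ.inv u hu]
  rw [lintegral_map hF (measurable_const_mul u)]

/-- The law of a left-invariant random unitary matrix gives to conjugation invariant functions the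
same mean as the random Hessenberg matrix with independent uniform determinant. -/
theorem lintegral_eq_hess_of_unitary_invariant {γ μ : Measure 𝕜} (hγ : IsIsotropic γ)
    (hμ : IsUniformPhase μ) {m : ℕ} {ν : Measure (Matrix (Fin (m + 1)) (Fin (m + 1)) 𝕜)}
    [IsProbabilityMeasure ν] (hmem : ∀ᵐ A ∂ν, A ∈ unitaryGroup (Fin (m + 1)) 𝕜)
    (hν : ∀ s ∈ unitaryGroup (Fin (m + 1)) 𝕜, ν.map (fun A => s * A) = ν)
    {f : Matrix (Fin (m + 1)) (Fin (m + 1)) 𝕜 → ℝ≥0∞} (hf : Measurable f) (hinv : ConjInvariant f) :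
    ∫⁻ A, f A ∂ν = ∫⁻ z, ∫⁻ w, f (hess m z w) ∂inputLaw γ m ∂μ := by
  have := hγ.prob
  have := hμ.prob
  have hmul : ∀ s ∈ unitaryGroup (Fin (m + 1)) 𝕜,
      ∀ g : Matrix (Fin (m + 1)) (Fin (m + 1)) 𝕜 → ℝ≥0∞, Measurable g →
      ∫⁻ A, g (s * A) ∂ν = ∫⁻ A, g A ∂ν := by
    intro s hs g hg
    conv_rhs => rw [← hν s hs]
    rw [lintegral_map hg (measurable_mul_left s)]
  set F : 𝕜 → ℝ≥0∞ := fun z => ∫⁻ w, f (hess m z w) ∂inputLaw γ m with hFdef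
  have hF : Measurable F :=
    Measurable.lintegral_prod_right' (f := fun p : 𝕜 × (Fin m → 𝕜 × 𝕜) => f (hess m p.1 p.2))
      (hf.comp (Measurable.hess m measurable_fst measurable_snd))
  obtain ⟨ρ, hρ, -⟩ := exists_isCosetHaar_lintegral_eq hγ m (ξ := 1) (by simp)
  have := hρ.prob
  have hfm : Measurable (Function.uncurry fun s A : Matrix (Fin (m + 1)) (Fin (m + 1)) 𝕜 =>
      f (s * A)) := hf.comp (measurable_fst.matrix_mul measurable_snd)
  have h1 : (fun s => ∫⁻ A, f (s * A) ∂ν) =ᵐ[ρ] fun _ => ∫⁻ A, f A ∂ν := by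
    filter_upwards [hρ.ae_mem] with s hs using hmul s hs.1 f hf
  -- For fixed `A`, the matrix `s A` is Haar on the coset of determinant `det A`, so averaging over
  -- `s` leaves a function of the determinant alone.
  have h2 : (fun A => ∫⁻ s, f (s * A) ∂ρ) =ᵐ[ν] fun A => F A.det := by
    filter_upwards [hmem] with A hA
    have h := hρ.map_mul_mul (one_mem _) hA
    rw [det_one, one_mul, one_mul] at h
    rw [hFdef]
    simp only
    rw [← h.lintegral_eq_hess hγ (norm_det_unitary hA) hf hinv, lintegral_map hf]
    · simp
    · exact (measurable_mul_left _).matrix_mul measurable_const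
  -- Left multiplication by `diag(z, 1, …, 1)` multiplies the determinant by `z` and preserves `ν`;
  -- averaging over a uniform `z` then makes the determinant uniform.
  have h3 : (fun z => ∫⁻ A, F (A.det * z) ∂ν) =ᵐ[μ] fun _ => ∫⁻ A, F A.det ∂ν := by
    filter_upwards [hμ.ae_norm] with z hz
    rw [← hmul _ (diagonal_cons_mem_unitary hz) (fun A => F A.det)
      (hF.comp measurable_id.matrix_det)]
    refine lintegral_congr fun A => ?_
    rw [det_mul, det_diagonal_cons, mul_comm]
  have h4 : (fun A : Matrix (Fin (m + 1)) (Fin (m + 1)) 𝕜 => ∫⁻ z, F (A.det * z) ∂μ)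
      =ᵐ[ν] fun _ => ∫⁻ z, F z ∂μ := by
    filter_upwards [hmem] with A hA using hμ.lintegral_mul_left (norm_det_unitary hA) hF
  have hFm : Measurable (Function.uncurry fun (z : 𝕜) (A : Matrix (Fin (m + 1)) (Fin (m + 1)) 𝕜) =>
      F (A.det * z)) := hF.comp (measurable_snd.matrix_det.mul measurable_fst)
  calc ∫⁻ A, f A ∂ν = ∫⁻ s, ∫⁻ A, f (s * A) ∂ν ∂ρ := by rw [lintegral_congr_ae h1]; simp
    _ = ∫⁻ A, ∫⁻ s, f (s * A) ∂ρ ∂ν := lintegral_lintegral_swap hfm.aemeasurable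
    _ = ∫⁻ A, F A.det ∂ν := lintegral_congr_ae h2
    _ = ∫⁻ z, ∫⁻ A, F (A.det * z) ∂ν ∂μ := by rw [lintegral_congr_ae h3]; simp
    _ = ∫⁻ A, ∫⁻ z, F (A.det * z) ∂μ ∂ν := lintegral_lintegral_swap hFm.aemeasurable
    _ = ∫⁻ z, F z ∂μ := by rw [lintegral_congr_ae h4]; simp

/-- Multiplying the determinant by a unit scalar which depends on the input does not change the law
of the random Hessenberg matrix with independent uniform determinant. -/
lemma lintegral_hess_mul_phase {γ μ : Measure 𝕜} [IsProbabilityMeasure γ] (hμ : IsUniformPhase μ)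
    {m : ℕ} {u : (Fin m → 𝕜 × 𝕜) → 𝕜} (hu1 : ∀ w, ‖u w‖ = 1)
    {f : Matrix (Fin (m + 1)) (Fin (m + 1)) 𝕜 → ℝ≥0∞} (hf : Measurable f) :
    ∫⁻ w, ∫⁻ z, f (hess m (z * u w) w) ∂μ ∂inputLaw γ m =
      ∫⁻ z, ∫⁻ w, f (hess m z w) ∂inputLaw γ m ∂μ := by
  have := hμ.prob
  have hm : Measurable (Function.uncurry fun (z : 𝕜) (w : Fin m → 𝕜 × 𝕜) => f (hess m z w)) :=
    hf.comp (Measurable.hess m measurable_fst measurable_snd)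
  rw [lintegral_lintegral_swap hm.aemeasurable]
  refine lintegral_congr fun w => ?_
  simp only [mul_comm _ (u w)]
  exact hμ.lintegral_mul_left (hu1 w) (F := fun z => f (hess m z w))
    (hm.comp measurable_prodMk_right)

end invariance

/-! ### Measurability of the eigenvalue map -/

lemma exists_unordered_eq {n : ℕ} (s : Sym ℂ n) : ∃ x : Fin n → ℂ, unordered x = s := by
  obtain ⟨s, hs⟩ := s
  induction s using Quotient.inductionOn with
  | h l =>
    subst hs
    refine ⟨l.get, Subtype.ext ?_⟩
    exact (Fin.univ_val_map _).trans (by rw [List.ofFn_get]; rfl)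

/-- The values at the natural numbers of the monic polynomial with roots `x`. -/
def rootValues {n : ℕ} (x : Fin n → ℂ) (k : ℕ) : ℂ := ∏ i, ((k : ℂ) - x i)

lemma measurable_rootValues {n : ℕ} : Measurable (rootValues (n := n)) :=
  measurable_pi_iff.2 fun _ => Finset.measurable_prod _ fun i _ =>
    measurable_const.sub (measurable_pi_apply i)

/-- Polynomials that agree at infinitely many points coincide, hence have the same multiset of
roots. Countably many evaluation points keep the target a countable product. -/
lemma unordered_eq_of_rootValues_eq {n : ℕ} {x y : Fin n → ℂ} (h : rootValues x = rootValues y) :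
    unordered x = unordered y := by
  have hp : (((Finset.univ : Finset (Fin n)).val.map x).map fun a => Polynomial.X - Polynomial.C a).prod
      = (((Finset.univ : Finset (Fin n)).val.map y).map fun a => Polynomial.X - Polynomial.C a).prod := by
    refine Polynomial.eq_of_infinite_eval_eq _ _ ?_
    refine (Set.infinite_range_of_injective (Nat.cast_injective (R := ℂ))).mono ?_
    rintro _ ⟨k, rfl⟩
    have hk := congrFun h k
    change Polynomial.eval _ _ = Polynomial.eval _ _
    rw [Polynomial.eval_multiset_prod, Polynomial.eval_multiset_prod]
    simp only [Multiset.map_map, Function.comp_def, Polynomial.eval_sub, Polynomial.eval_X,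
      Polynomial.eval_C]
    exact hk
  have hr := congrArg Polynomial.roots hp
  rw [Polynomial.roots_multiset_prod_X_sub_C, Polynomial.roots_multiset_prod_X_sub_C] at hr
  exact Subtype.ext hr

lemma eval_charpoly_eq_rootValues {n : ℕ} (A : Matrix (Fin n) (Fin n) ℂ) {x : Fin n → ℂ}
    (hx : unordered x = eigenvalues A) (k : ℕ) : A.charpoly.eval (k : ℂ) = rootValues x k := by
  rw [(IsAlgClosed.splits A.charpoly).eval_eq_prod_roots_of_monic (charpoly_monic A)]
  have h : A.charpoly.roots = (Finset.univ : Finset (Fin n)).val.map x :=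
    (congrArg Subtype.val hx).symm
  rw [h, Multiset.map_map]
  rfl

/-- No measurable ordering of the eigenvalues is needed: the values of the characteristic polynomial
at the integers `k ≥ 0` are measurable in the matrix and separate unordered tuples. -/
lemma measurable_eigenvalues {n : ℕ} :
    Measurable (eigenvalues : Matrix (Fin n) (Fin n) ℂ → Sym ℂ n) := by
  intro S hS
  have hB : MeasurableSet (unordered ⁻¹' S : Set (Fin n → ℂ)) := hS
  -- This ordering need not be measurable; only its symmetric functions `rootValues (x A)` enter,
  -- and they are determinants.
  choose x hx using fun A : Matrix (Fin n) (Fin n) ℂ => exists_unordered_eq (eigenvalues A)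
  set g : Matrix (Fin n) (Fin n) ℂ → Set.range (rootValues (n := n)) :=
    fun A => ⟨rootValues (x A), x A, rfl⟩ with hg
  have hgm : Measurable g := by
    refine Measurable.subtype_mk (measurable_pi_iff.2 fun k => ?_)
    have : (fun A => rootValues (x A) k) = fun A : Matrix (Fin n) (Fin n) ℂ =>
        (Matrix.scalar (Fin n) (k : ℂ) - A).det := by
      ext1 A
      rw [← eval_charpoly_eq_rootValues A (hx A), eval_charpoly]
    rw [this]
    refine Measurable.matrix_det (measurable_matrix_iff.2 fun i j => ?_)
    exact measurable_const.sub (measurable_id.matrix_apply i j)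
  have hpre : rootValues ⁻¹' (rootValues '' (unordered ⁻¹' S)) = (unordered ⁻¹' S : Set (Fin n → ℂ)) := by
    refine Set.Subset.antisymm ?_ (Set.subset_preimage_image _ _)
    rintro y ⟨z, hz, hzy⟩
    rw [Set.mem_preimage] at hz ⊢
    rwa [← unordered_eq_of_rootValues_eq hzy]
  have hs : MeasurableSet ((↑) ⁻¹' (rootValues '' (unordered ⁻¹' S)) :
      Set (Set.range (rootValues (n := n)))) := by
    -- Descriptive set theory: for a Borel map on a standard Borel space, a subset of the range is
    -- measurable as soon as its preimage is Borel.
    rw [← measurable_rootValues.measurableSet_preimage_iff_preimage_val, hpre]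
    exact hB
  have : eigenvalues ⁻¹' S = g ⁻¹' ((↑) ⁻¹' (rootValues '' (unordered ⁻¹' S))) := by
    ext A
    have h2 : x A ∈ rootValues ⁻¹' (rootValues '' (unordered ⁻¹' S)) ↔ x A ∈ unordered ⁻¹' S := by
      rw [hpre]
    rw [Set.mem_preimage, ← hx A]
    exact h2.symm
  rw [this]
  exact hgm hs

lemma eigenvalues_conj {n : ℕ} {W : Matrix (Fin n) (Fin n) ℂ} (hW : W ∈ unitaryGroup (Fin n) ℂ)
    (A : Matrix (Fin n) (Fin n) ℂ) : eigenvalues (W * A * star W) = eigenvalues A := by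
  refine Subtype.ext ?_
  change (W * A * star W).charpoly.roots = A.charpoly.roots
  rw [charpoly_mul_comm, ← mul_assoc, mem_unitaryGroup_iff'.1 hW, one_mul]

lemma conjInvariant_eigenvalues {m : ℕ} :
    ConjInvariant (eigenvalues : Matrix (Fin (m + 1)) (Fin (m + 1)) ℂ → Sym ℂ (m + 1)) :=
  fun _ hV A => eigenvalues_conj (bordered_mem_unitary hV) A

lemma toComplex_mem_unitary {n : ℕ} {A : Matrix (Fin n) (Fin n) ℝ}
    (hA : A ∈ unitaryGroup (Fin n) ℝ) : toComplex A ∈ unitaryGroup (Fin n) ℂ := by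
  rw [mem_unitaryGroup_iff] at *
  rw [← toComplex_star, ← toComplex_mul, hA, toComplex_one]

lemma conjInvariant_eigenvalues_toComplex {m : ℕ} :
    ConjInvariant fun A : Matrix (Fin (m + 1)) (Fin (m + 1)) ℝ => eigenvalues (toComplex A) := by
  intro V hV A
  simp only [toComplex_mul, toComplex_star]
  exact eigenvalues_conj (toComplex_mem_unitary (bordered_mem_unitary hV)) _

lemma measurable_toComplex {n : ℕ} :
    Measurable (toComplex : Matrix (Fin n) (Fin n) ℝ → Matrix (Fin n) (Fin n) ℂ) :=
  measurable_matrix_iff.2 fun i j => Complex.measurable_ofReal.comp (measurable_id.matrix_apply i j)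

/-! ### Isotropy of the Gaussian laws -/

section isotropic

variable {𝕜 : Type*} [RCLike 𝕜] [MeasurableSpace 𝕜] [BorelSpace 𝕜]

lemma inner_toLp_eq_re {n : ℕ} (x t : Fin n → 𝕜) :
    inner ℝ (WithLp.toLp 2 x) (WithLp.toLp 2 t) = RCLike.re (star x ⬝ᵥ t) := by
  simp only [PiLp.inner_apply, dotProduct, map_sum]
  refine Finset.sum_congr rfl fun i _ => ?_
  change RCLike.re (t i * star (x i)) = _
  rw [mul_comm]
  rfl

/-- The characteristic function of the product is `exp (-c ‖t‖²)`, a function of the norm alone, and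
applying `U` to the vector amounts to replacing `t` by `U* t`. -/
lemma map_mulVec_pi_of_charFun {γ : Measure 𝕜} [IsProbabilityMeasure γ] {c : ℝ}
    (h : ∀ t, charFun γ t = Complex.exp ((-(c * ‖t‖ ^ 2) : ℝ) : ℂ)) {n : ℕ}
    {U : Matrix (Fin n) (Fin n) 𝕜} (hU : U ∈ unitaryGroup (Fin n) 𝕜) :
    (Measure.pi fun _ : Fin n => γ).map (fun x => U *ᵥ x) = Measure.pi fun _ : Fin n => γ := by
  have hprod : ∀ t : Fin n → 𝕜, ∏ i, charFun γ (t i) = Complex.exp ((-(c * nrm t ^ 2) : ℝ) : ℂ) := by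
    intro t
    simp only [h, ← Complex.exp_sum, ← Complex.ofReal_sum]
    rw [nrm_sq, Finset.mul_sum, Finset.sum_neg_distrib]
  have hmv : Measurable fun x : Fin n → 𝕜 => U *ᵥ x := by
    refine measurable_pi_iff.2 fun i => ?_
    simp only [mulVec, dotProduct]
    exact Finset.measurable_sum _ fun j _ => measurable_const.mul (measurable_pi_apply j)
  have := Measure.isProbabilityMeasure_map (μ := Measure.pi fun _ : Fin n => γ) hmv.aemeasurable
  refine (charFun_eq_pi_iff (μ := fun _ : Fin n => γ)).1 fun t => ?_
  have hpi := charFun_pi (μ := fun _ : Fin n => γ) (WithLp.toLp 2 (star U *ᵥ t.ofLp))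
  rw [hprod t.ofLp]
  change _ = ∏ i, charFun γ ((star U *ᵥ t.ofLp) i) at hpi
  rw [hprod, nrm_mulVec (Unitary.star_mem hU)] at hpi
  rw [← hpi, Measure.map_map (WithLp.measurable_toLp 2 _) hmv, charFun_apply, charFun_apply,
    integral_map ((WithLp.measurable_toLp 2 _).comp hmv).aemeasurable (by fun_prop),
    integral_map (WithLp.measurable_toLp 2 _).aemeasurable (by fun_prop)]
  refine integral_congr_ae (Filter.Eventually.of_forall fun x => ?_)
  have h1 := inner_toLp_eq_re (U *ᵥ x) t.ofLp
  have h2 := inner_toLp_eq_re x (star U *ᵥ t.ofLp)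
  simp only [Function.comp_apply]
  rw [h2]
  change Complex.exp (((inner ℝ (WithLp.toLp 2 (U *ᵥ x)) (WithLp.toLp 2 t.ofLp) : ℝ) : ℂ) * _) = _
  rw [h1, star_mulVec, dotProduct_mulVec, star_eq_conjTranspose]

end isotropic

instance isProbabilityMeasure_complexGaussian (c : ℂ) (s : ℝ≥0) :
    IsProbabilityMeasure (complexGaussian c s) :=
  Measure.isProbabilityMeasure_map (by fun_prop)

lemma charFun_complexGaussian (t : ℂ) :
    charFun (complexGaussian 0 1) t = Complex.exp ((-(1 / 4 * ‖t‖ ^ 2) : ℝ) : ℂ) := by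
  rw [complexGaussian, charFun_apply, integral_map (by fun_prop) (by fun_prop)]
  have : ∀ p : ℝ × ℝ, Complex.exp ((inner ℝ ((p.1 : ℂ) + p.2 * Complex.I) t : ℝ) * Complex.I) =
      Complex.exp ((inner ℝ p.1 t.re : ℝ) * Complex.I) *
        Complex.exp ((inner ℝ p.2 t.im : ℝ) * Complex.I) := by
    intro p
    rw [← Complex.exp_add, ← add_mul, ← Complex.ofReal_add]
    congr 3
    simp [Complex.inner]
  simp only [this]
  rw [integral_prod_mul (fun a : ℝ => Complex.exp ((inner ℝ a t.re : ℝ) * Complex.I))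
    (fun a : ℝ => Complex.exp ((inner ℝ a t.im : ℝ) * Complex.I)), ← charFun_apply, ← charFun_apply,
    charFun_gaussianReal, charFun_gaussianReal, ← Complex.exp_add, ← Complex.normSq_eq_norm_sq,
    Complex.normSq_apply]
  congr 1
  push_cast
  simp
  ring

lemma isIsotropic_complexGaussian : IsIsotropic (complexGaussian 0 1) where
  prob := inferInstance
  zero := by
    have : NullSingletonClass (gaussianReal 0 (1 / 2)) := nullSingletonClass_gaussianReal (by simp)
    rw [complexGaussian, Measure.map_apply (by fun_prop) (measurableSet_singleton 0)]
    refine measure_mono_null (t := {0} ×ˢ Set.univ) (fun p hp => ?_) ?_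
    · have := congrArg Complex.re (show (p.1 : ℂ) + p.2 * Complex.I = 0 from hp)
      simpa using this
    · rw [Measure.prod_prod, Complex.zero_re, measure_singleton, zero_mul]
  inv _ _ hU := map_mulVec_pi_of_charFun charFun_complexGaussian hU

lemma isIsotropic_gaussianReal : IsIsotropic (gaussianReal 0 1) where
  prob := inferInstance
  zero := by
    have : NullSingletonClass (gaussianReal 0 1) := nullSingletonClass_gaussianReal (by simp)
    exact measure_singleton 0
  inv _ _ hU := map_mulVec_pi_of_charFun (c := 1 / 2) (fun t => by
    rw [charFun_gaussianReal]
    congr 1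
    simp
    ring) hU

/-! ### Uniform phases -/

lemma isUniformPhase_of_lintegral {𝕜 : Type*} [RCLike 𝕜] [MeasurableSpace 𝕜] [BorelSpace 𝕜]
    {τ : Measure ℝ} [IsProbabilityMeasure τ] {e : ℝ → 𝕜} (he : Measurable e)
    (h1 : ∀ᵐ θ ∂τ, ‖e θ‖ = 1)
    (h : ∀ u : 𝕜, ‖u‖ = 1 → ∀ F : 𝕜 → ℝ≥0∞, ∫⁻ θ, F (u * e θ) ∂τ = ∫⁻ θ, F (e θ) ∂τ) :
    IsUniformPhase (τ.map e) where
  prob := Measure.isProbabilityMeasure_map he.aemeasurable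
  ae_norm := (ae_map_iff he.aemeasurable (measurable_norm (measurableSet_singleton 1))).2 h1
  inv u hu := by
    refine Measure.ext_of_lintegral _ fun F hF => ?_
    rw [lintegral_map hF (measurable_const_mul u),
      lintegral_map (f := fun z => F (u * z)) (hF.comp (measurable_const_mul u)) he, lintegral_map hF he]
    exact h u hu F

lemma isProbabilityMeasure_uniform_angle :
    IsProbabilityMeasure (ProbabilityTheory.cond volume (Set.Ioc (-Real.pi) Real.pi)) := by
  refine cond_isProbabilityMeasure_of_finite ?_ ?_ <;> simp [Real.pi_pos]

/-- Multiplication by `exp (i φ)` translates the angle, and Lebesgue measure on the circle of length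
`2π` is translation invariant. The minus sign is harmless. -/
lemma isUniformPhase_complex :
    IsUniformPhase ((ProbabilityTheory.cond volume (Set.Ioc (-Real.pi) Real.pi)).map
      fun θ : ℝ => -Complex.exp ((θ : ℂ) * Complex.I)) := by
  have := isProbabilityMeasure_uniform_angle
  refine isUniformPhase_of_lintegral (by fun_prop) (Filter.Eventually.of_forall fun θ => by
    rw [norm_neg, Complex.norm_exp_ofReal_mul_I]) fun u hu F => ?_
  obtain ⟨φ, rfl⟩ := (Complex.norm_eq_one_iff u).1 hu
  have : Fact (0 < 2 * Real.pi) := ⟨Real.two_pi_pos⟩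
  have hper : Function.Periodic (fun θ : ℝ => F (-Complex.exp ((θ : ℂ) * Complex.I)))
      (2 * Real.pi) := by
    intro θ
    simp only
    congr 2
    push_cast
    rw [add_mul, Complex.exp_add, Complex.exp_two_pi_mul_I, mul_one]
  rw [ProbabilityTheory.cond, lintegral_smul_measure, lintegral_smul_measure]
  congr 1
  have hI : Set.Ioc (-Real.pi) Real.pi = Set.Ioc (-Real.pi) (-Real.pi + 2 * Real.pi) := by
    congr 1; ring
  have h1 := AddCircle.lintegral_preimage (2 * Real.pi) (-Real.pi) hper.lift
  have h2 := AddCircle.lintegral_preimage (2 * Real.pi) (-Real.pi)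
    fun b => hper.lift (b + ((φ : ℝ) : AddCircle (2 * Real.pi)))
  rw [lintegral_add_right_eq_self, ← h1] at h2
  rw [hI]
  simp only [← AddCircle.coe_add, hper.lift_coe] at h1 h2
  rw [← h2]
  refine lintegral_congr fun θ => ?_
  congr 1
  push_cast
  rw [add_mul, Complex.exp_add]
  ring

lemma isUniformPhase_real :
    IsUniformPhase ((uniformOn {0, Real.pi}).map fun θ : ℝ => -Real.cos θ) := by
  have hne : (0 : ℝ) ∉ ({Real.pi} : Set ℝ) := by simpa using Real.pi_ne_zero.symm
  have hfin : ({0, Real.pi} : Set ℝ).Finite := Set.toFinite _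
  have : IsProbabilityMeasure (uniformOn ({0, Real.pi} : Set ℝ)) :=
    isProbabilityMeasure_uniformOn hfin ⟨0, by simp⟩
  refine isUniformPhase_of_lintegral (by fun_prop) ?_ fun u hu F => ?_
  · have hmem : ∀ᵐ θ ∂(uniformOn ({0, Real.pi} : Set ℝ)), θ ∈ ({0, Real.pi} : Set ℝ) :=
      ae_cond_mem hfin.measurableSet
    filter_upwards [hmem] with θ hθ
    rcases hθ with rfl | rfl <;> simp
  · have key : ∀ G : ℝ → ℝ≥0∞, ∫⁻ θ in ({0, Real.pi} : Set ℝ), G θ ∂Measure.count =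
        G 0 + G Real.pi := by
      intro G
      rw [lintegral_insert hne, Measure.restrict_singleton]
      simp
    rw [uniformOn, ProbabilityTheory.cond, lintegral_smul_measure, lintegral_smul_measure, key, key]
    congr 1
    rcases (abs_eq zero_le_one).1 (show |u| = 1 from hu) with rfl | rfl
    · simp
    · simp [add_comm]

/-! ### The random input -/

section input

variable {𝕜 : Type*} [RCLike 𝕜] [MeasurableSpace 𝕜] [BorelSpace 𝕜]
  {Ω : Type*} [MeasurableSpace Ω] {P : Measure Ω} {m : ℕ} {α β : Fin m → Ω → 𝕜} {γ : Measure 𝕜}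

/-- Independent pairs `(α_j, β_j)` with independent components, where `α_j` has law `γ` and `β_j ^ 2`
has the law of the sum of the squared moduli of `m - j` independent variables of law `γ`. -/
structure IsScalarInput (γ : Measure 𝕜) (P : Measure Ω) (α β : Fin m → Ω → 𝕜) : Prop where
  law_alpha : ∀ j, HasLaw (α j) γ P
  aemeasurable_beta : ∀ j, AEMeasurable (β j) P
  law_beta_sq : ∀ j : Fin m, HasLaw (fun ω => β j ω ^ 2)
    ((Measure.pi fun _ : Fin (m - j) => γ).map fun δ => ((∑ i, ‖δ i‖ ^ 2 : ℝ) : 𝕜)) P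
  indep_components : ∀ j, IndepFun (α j) (β j) P
  indep_pairs : iIndepFun (fun j ω => (α j ω, β j ω)) P

lemma measurable_norm_coe : Measurable fun z : 𝕜 => (‖z‖ : 𝕜) :=
  RCLike.continuous_ofReal.measurable.comp measurable_norm

lemma measurable_sum_norm_sq {k : ℕ} :
    Measurable fun δ : Fin k → 𝕜 => ((∑ i, ‖δ i‖ ^ 2 : ℝ) : 𝕜) :=
  RCLike.continuous_ofReal.measurable.comp
    (Finset.measurable_sum _ fun i _ => (measurable_pi_apply i).norm.pow_const 2)

namespace IsScalarInput

lemma aemeasurable (h : IsScalarInput γ P α β) :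
    AEMeasurable (fun ω j => (α j ω, β j ω)) P :=
  aemeasurable_pi_lambda _ fun j => (h.law_alpha j).aemeasurable.prodMk (h.aemeasurable_beta j)

/-- The modulus of `β_j` is a function of `β_j ^ 2`, so its law is determined although that of `β_j`
is not. -/
lemma map_norm_beta (h : IsScalarInput γ P α β) (j : Fin m) :
    P.map (fun ω => (‖β j ω‖ : 𝕜)) = chiLaw γ (m - j) := by
  have hs : Measurable fun z : 𝕜 => ((Real.sqrt ‖z‖ : ℝ) : 𝕜) :=
    RCLike.continuous_ofReal.measurable.comp measurable_norm.sqrt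
  have e : (fun ω => (‖β j ω‖ : 𝕜)) = (fun z : 𝕜 => ((Real.sqrt ‖z‖ : ℝ) : 𝕜)) ∘ fun ω => β j ω ^ 2 := by
    ext1 ω
    simp
  rw [e, ← AEMeasurable.map_map_of_aemeasurable hs.aemeasurable (h.law_beta_sq j).aemeasurable,
    (h.law_beta_sq j).map_eq, Measure.map_map hs measurable_sum_norm_sq, chiLaw]
  congr 1
  ext1 δ
  simp only [Function.comp_apply, nrm]
  rw [RCLike.norm_ofReal, abs_of_nonneg (by positivity)]

lemma map_eq_inputLaw [IsProbabilityMeasure P] (h : IsScalarInput γ P α β) :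
    P.map (fun ω j => (α j ω, (‖β j ω‖ : 𝕜))) = inputLaw γ m := by
  have hβ : ∀ j, AEMeasurable (fun ω => (‖β j ω‖ : 𝕜)) P := fun j =>
    measurable_norm_coe.comp_aemeasurable (h.aemeasurable_beta j)
  have hpair := h.indep_pairs.comp (fun _ p => (p.1, (‖p.2‖ : 𝕜))) fun _ =>
    measurable_fst.prodMk (measurable_norm_coe.comp measurable_snd)
  have := hpair.map_fun_eq_pi_map fun j => (h.law_alpha j).aemeasurable.prodMk (hβ j)
  refine this.trans ?_
  unfold inputLaw
  congr 1
  ext1 j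
  have hc := (h.indep_components j).comp measurable_id measurable_norm_coe
  rw [← h.map_norm_beta j, ← (h.law_alpha j).map_eq]
  exact hc.map_prod_eq_prod_map_map (h.law_alpha j).aemeasurable (hβ j)

/-- Almost surely `β_j ^ 2` is real and nonnegative, so even over `ℂ` its square root `β_j` is real
and only a sign is undetermined. -/
lemma ae_eq_or_eq_neg (h : IsScalarInput γ P α β) :
    ∀ᵐ ω ∂P, ∀ j, β j ω = (‖β j ω‖ : 𝕜) ∨ β j ω = -(‖β j ω‖ : 𝕜) := by
  refine ae_all_iff.2 fun j => ?_
  have hm : MeasurableSet {z : 𝕜 | z = (‖z‖ : 𝕜)} :=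
    measurableSet_eq_fun measurable_id measurable_norm_coe
  have h1 : ∀ᵐ z ∂(P.map fun ω => β j ω ^ 2), z = (‖z‖ : 𝕜) := by
    rw [(h.law_beta_sq j).map_eq, ae_map_iff measurable_sum_norm_sq.aemeasurable hm]
    refine Filter.Eventually.of_forall fun δ => ?_
    rw [RCLike.norm_ofReal, abs_of_nonneg (by positivity)]
  have h2 := (ae_map_iff (h.law_beta_sq j).aemeasurable hm).1 h1
  filter_upwards [h2] with ω hω
  refine sq_eq_sq_iff_eq_or_eq_neg.1 ?_
  rw [hω]
  simp

lemma ae_alpha_ne_zero (h : IsScalarInput γ P α β) (hγ : IsIsotropic γ) :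
    ∀ᵐ ω ∂P, ∀ j, α j ω ≠ 0 := by
  refine ae_all_iff.2 fun j => ?_
  have h1 : ∀ᵐ z ∂(P.map (α j)), z ≠ 0 := by
    rw [(h.law_alpha j).map_eq, ae_iff]
    simpa using hγ.zero
  exact ae_of_ae_map (h.law_alpha j).aemeasurable h1

lemma aemeasurable_norm (h : IsScalarInput γ P α β) :
    AEMeasurable (fun ω j => (α j ω, (‖β j ω‖ : 𝕜))) P :=
  aemeasurable_pi_lambda _ fun j => (h.law_alpha j).aemeasurable.prodMk
    (measurable_norm_coe.comp_aemeasurable (h.aemeasurable_beta j))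

lemma lintegral_hess [IsProbabilityMeasure P] (h : IsScalarInput γ P α β) (ξ : 𝕜)
    {f : Matrix (Fin (m + 1)) (Fin (m + 1)) 𝕜 → ℝ≥0∞} (hf : Measurable f) (hinv : ConjInvariant f) :
    ∫⁻ ω, f (hess m ξ fun j => (α j ω, β j ω)) ∂P = ∫⁻ w, f (hess m ξ w) ∂inputLaw γ m := by
  have hm : Measurable fun w => f (hess m ξ w) :=
    hf.comp (Measurable.hess m measurable_const measurable_id)
  rw [← h.map_eq_inputLaw, lintegral_map' hm.aemeasurable h.aemeasurable_norm]
  refine lintegral_congr_ae ?_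
  filter_upwards [h.ae_eq_or_eq_neg] with ω hω
  exact hinv.hess_sign m ξ hω

lemma lintegral_hess_mul_phase [IsProbabilityMeasure P] [IsProbabilityMeasure γ] {μ : Measure 𝕜}
    (h : IsScalarInput γ P α β) (hμ : IsUniformPhase μ) {ζ : Ω → 𝕜} (hζ : HasLaw ζ μ P)
    (hind : IndepFun (fun ω j => (α j ω, β j ω)) ζ P)
    {f : Matrix (Fin (m + 1)) (Fin (m + 1)) 𝕜 → ℝ≥0∞} (hf : Measurable f) (hinv : ConjInvariant f) :
    ∫⁻ ω, f (hess m (ζ ω * ∏ j, unitPhase (α j ω)) fun j => (α j ω, β j ω)) ∂P =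
      ∫⁻ z, ∫⁻ w, f (hess m z w) ∂inputLaw γ m ∂μ := by
  have := hμ.prob
  have hu : Measurable fun w : Fin m → 𝕜 × 𝕜 => ∏ j, unitPhase (w j).1 :=
    Finset.measurable_prod _ fun j _ => measurable_unitPhase.comp (measurable_pi_apply j).fst
  have hm : Measurable fun p : (Fin m → 𝕜 × 𝕜) × 𝕜 =>
      f (hess m (p.2 * ∏ j, unitPhase (p.1 j).1) p.1) :=
    hf.comp (Measurable.hess m (measurable_snd.mul (hu.comp measurable_fst)) measurable_fst)
  have habs : Measurable fun (w : Fin m → 𝕜 × 𝕜) j => ((w j).1, (‖(w j).2‖ : 𝕜)) :=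
    measurable_pi_iff.2 fun j => (measurable_pi_apply j).fst.prodMk
      (measurable_norm_coe.comp (measurable_pi_apply j).snd)
  have hjoint := (hind.comp habs measurable_id).map_prod_eq_prod_map_map h.aemeasurable_norm
    hζ.aemeasurable
  have hlaw : P.map (fun ω => ((fun j => (α j ω, (‖β j ω‖ : 𝕜))), ζ ω)) = (inputLaw γ m).prod μ := by
    rw [← h.map_eq_inputLaw, ← hζ.map_eq]
    exact hjoint
  rw [← HaarHess.lintegral_hess_mul_phase hμ (u := fun w => ∏ j, unitPhase (w j).1)
    (fun w => norm_prod_unitPhase _) hf,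
    ← lintegral_prod (fun p : (Fin m → 𝕜 × 𝕜) × 𝕜 => f (hess m (p.2 * ∏ j, unitPhase (p.1 j).1) p.1))
      hm.aemeasurable, ← hlaw,
    lintegral_map' hm.aemeasurable (h.aemeasurable_norm.prodMk hζ.aemeasurable)]
  refine lintegral_congr_ae ?_
  filter_upwards [h.ae_eq_or_eq_neg] with ω hω
  exact hinv.hess_sign m _ hω

end IsScalarInput

end input

lemma IsComplexInput.isScalarInput {Ω : Type*} [MeasurableSpace Ω] {P : Measure Ω} {m : ℕ}
    {α β : Fin m → Ω → ℂ} (h : IsComplexInput P m α β) :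
    IsScalarInput (complexGaussian 0 1) P α β where
  law_alpha := h.law_alpha
  aemeasurable_beta := h.aemeasurable_beta
  law_beta_sq j := by
    have := h.law_beta_sq j
    rwa [chiSqComplex, Measure.map_map (by fun_prop) (by fun_prop)] at this
  indep_components := h.indep_components
  indep_pairs := h.indep_pairs

lemma IsRealInput.isScalarInput {Ω : Type*} [MeasurableSpace Ω] {P : Measure Ω} {m : ℕ}
    {α β : Fin m → Ω → ℝ} (h : IsRealInput P m α β) :
    IsScalarInput (gaussianReal 0 1) P α β where
  law_alpha := h.law_alpha
  aemeasurable_beta := h.aemeasurable_beta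
  law_beta_sq j := by
    have := h.law_beta_sq j
    rw [chiSqReal] at this
    simpa using this
  indep_components := h.indep_components
  indep_pairs := h.indep_pairs

/-! ### Haar measures on the matrix groups -/

lemma IsNormalizedHaar.map_mul_left {G : Type*} [Group G] [MeasurableSpace G] {ν : Measure G}
    (hν : IsNormalizedHaar ν) (hm : ∀ g : G, Measurable fun x => g * x) (g : G) :
    ν.map (fun x => g * x) = ν := by
  ext S hS
  rw [Measure.map_apply (hm g) hS, ← hν.left_invariant g _ (hm g hS)]
  congr 1
  exact Set.image_preimage_eq _ (mul_left_surjective g)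

section haar

variable {𝕜 : Type*} [RCLike 𝕜] [MeasurableSpace 𝕜] [BorelSpace 𝕜]

lemma IsNormalizedHaar.map_val_mul_left {n : ℕ} {ν : Measure (unitaryGroup (Fin n) 𝕜)}
    (hν : IsNormalizedHaar ν) {s : Matrix (Fin n) (Fin n) 𝕜} (hs : s ∈ unitaryGroup (Fin n) 𝕜) :
    (ν.map Subtype.val).map (fun A => s * A) = ν.map Subtype.val := by
  have hm : ∀ g : unitaryGroup (Fin n) 𝕜, Measurable fun x => g * x := fun g =>
    Measurable.subtype_mk ((measurable_mul_left g.1).comp measurable_subtype_coe)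
  rw [Measure.map_map (measurable_mul_left s) measurable_subtype_coe]
  conv_rhs => rw [← hν.map_mul_left hm ⟨s, hs⟩, Measure.map_map measurable_subtype_coe (hm _)]
  rfl

lemma IsNormalizedHaar.isCosetHaar {n : ℕ} {ν : Measure (specialUnitaryGroup (Fin n) 𝕜)}
    (hν : IsNormalizedHaar ν) {U : Matrix (Fin n) (Fin n) 𝕜} (hU : U ∈ unitaryGroup (Fin n) 𝕜) :
    IsCosetHaar U.det (ν.map fun Q => U * Q.1) := by
  have := hν.isProbability
  have hm : ∀ g : specialUnitaryGroup (Fin n) 𝕜, Measurable fun x => g * x := fun g =>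
    Measurable.subtype_mk ((measurable_mul_left g.1).comp measurable_subtype_coe)
  have h1 : IsCosetHaar 1 (ν.map Subtype.val) := by
    refine ⟨Measure.isProbabilityMeasure_map measurable_subtype_coe.aemeasurable, ?_, fun s hs => ?_⟩
    · rw [ae_map_iff measurable_subtype_coe.aemeasurable (measurableSet_unitary_det 1)]
      exact Filter.Eventually.of_forall fun Q => mem_specialUnitaryGroup_iff.1 Q.2
    · rw [Measure.map_map (measurable_mul_left s) measurable_subtype_coe]
      conv_rhs => rw [← hν.map_mul_left hm ⟨s, hs⟩, Measure.map_map measurable_subtype_coe (hm _)]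
      rfl
  have h2 := h1.map_mul_mul hU (one_mem _)
  rw [Measure.map_map ((measurable_mul_left U).matrix_mul measurable_const) measurable_subtype_coe,
    det_one, mul_one, mul_one] at h2
  have e : ((fun A => U * A * 1) ∘ Subtype.val : specialUnitaryGroup (Fin n) 𝕜 → _) =
      fun Q => U * Q.1 := by
    ext1 Q
    simp
  rwa [e] at h2

lemma ConjInvariant.comp {n : ℕ} {δ ε : Type*}
    {f : Matrix (Fin (n + 1)) (Fin (n + 1)) 𝕜 → δ} (hf : ConjInvariant f) (φ : δ → ε) :
    ConjInvariant fun A => φ (f A) := fun V hV A => congrArg φ (hf V hV A)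

lemma identDistrib_of_lintegral {Ω Ω' S : Type*} [MeasurableSpace Ω] [MeasurableSpace Ω']
    [MeasurableSpace S] {P : Measure Ω} {ν : Measure Ω'} {X : Ω → S} {Y : Ω' → S}
    (hX : AEMeasurable X P) (hY : AEMeasurable Y ν)
    (h : ∀ φ : S → ℝ≥0∞, Measurable φ → ∫⁻ ω, φ (X ω) ∂P = ∫⁻ ω, φ (Y ω) ∂ν) :
    IdentDistrib X Y P ν := by
  refine ⟨hX, hY, Measure.ext_of_lintegral _ fun φ hφ => ?_⟩
  rw [lintegral_map' hφ.aemeasurable hX, lintegral_map' hφ.aemeasurable hY]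
  exact h φ hφ

variable {Ω : Type*} [MeasurableSpace Ω] {P : Measure Ω} [IsProbabilityMeasure P] {m : ℕ}
  {α β : Fin m → Ω → 𝕜} {γ : Measure 𝕜} {S : Type*} [MeasurableSpace S]
  {e : Matrix (Fin (m + 1)) (Fin (m + 1)) 𝕜 → S}

/-- A conjugation invariant statistic has the same law under the random Hessenberg matrix of
determinant `ξ` and on the corresponding coset of the special unitary group. -/
theorem IsScalarInput.identDistrib_special (h : IsScalarInput γ P α β) (hγ : IsIsotropic γ)
    (he : Measurable e) (hinv : ConjInvariant e)
    {ν : Measure (specialUnitaryGroup (Fin (m + 1)) 𝕜)} (hν : IsNormalizedHaar ν)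
    {U : Matrix (Fin (m + 1)) (Fin (m + 1)) 𝕜} (hU : U ∈ unitaryGroup (Fin (m + 1)) 𝕜) :
    IdentDistrib (fun ω => e (hess m U.det fun j => (α j ω, β j ω)))
      (fun Q : specialUnitaryGroup (Fin (m + 1)) 𝕜 => e (U * Q.1)) P ν := by
  have hUm : Measurable fun Q : specialUnitaryGroup (Fin (m + 1)) 𝕜 => U * Q.1 :=
    (measurable_mul_left U).comp measurable_subtype_coe
  refine identDistrib_of_lintegral ?_ (he.comp hUm).aemeasurable fun φ hφ => ?_
  · exact (he.comp (Measurable.hess m measurable_const measurable_id)).comp_aemeasurable h.aemeasurable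
  · have hφe : Measurable fun A => φ (e A) := hφ.comp he
    rw [h.lintegral_hess U.det hφe (hinv.comp φ),
      ← (hν.isCosetHaar hU).lintegral_eq_hess hγ (norm_det_unitary hU) hφe (hinv.comp φ),
      lintegral_map hφe hUm]

/-- A conjugation invariant statistic has the same law under the random Hessenberg matrix with
independent uniform last phase and on the unitary group. -/
theorem IsScalarInput.identDistrib_unitary (h : IsScalarInput γ P α β) (hγ : IsIsotropic γ)
    {μ : Measure 𝕜} (hμ : IsUniformPhase μ) {ζ : Ω → 𝕜} (hζ : HasLaw ζ μ P)
    (hind : IndepFun (fun ω j => (α j ω, β j ω)) ζ P)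
    (he : Measurable e) (hinv : ConjInvariant e)
    {ν : Measure (unitaryGroup (Fin (m + 1)) 𝕜)} (hν : IsNormalizedHaar ν) :
    IdentDistrib (fun ω => e (hess m (ζ ω * ∏ j, unitPhase (α j ω)) fun j => (α j ω, β j ω)))
      (fun Q : unitaryGroup (Fin (m + 1)) 𝕜 => e Q.1) P ν := by
  have := hγ.prob
  have := hν.isProbability
  refine identDistrib_of_lintegral ?_ (he.comp measurable_subtype_coe).aemeasurable fun φ hφ => ?_
  · have hm : Measurable fun p : (Fin m → 𝕜 × 𝕜) × 𝕜 =>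
        e (hess m (p.2 * ∏ j, unitPhase (p.1 j).1) p.1) :=
      he.comp (Measurable.hess m (measurable_snd.mul (Finset.measurable_prod _ fun j _ =>
        measurable_unitPhase.comp ((measurable_pi_apply j).comp measurable_fst).fst)) measurable_fst)
    exact hm.comp_aemeasurable (h.aemeasurable.prodMk hζ.aemeasurable)
  · have := Measure.isProbabilityMeasure_map (μ := ν) measurable_subtype_coe.aemeasurable
    have hmem : ∀ᵐ A ∂(ν.map Subtype.val), A ∈ unitaryGroup (Fin (m + 1)) 𝕜 := by
      have hset : MeasurableSet {A : Matrix (Fin (m + 1)) (Fin (m + 1)) 𝕜 |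
          A ∈ unitaryGroup (Fin (m + 1)) 𝕜} := measurableSet_unitary
      rw [ae_map_iff measurable_subtype_coe.aemeasurable hset]
      exact Filter.Eventually.of_forall fun Q => Q.2
    have hφe : Measurable fun A => φ (e A) := hφ.comp he
    rw [h.lintegral_hess_mul_phase hμ hζ hind hφe (hinv.comp φ),
      ← lintegral_eq_hess_of_unitary_invariant hγ hμ hmem (fun s hs => hν.map_val_mul_left hs)
        hφe (hinv.comp φ), lintegral_map hφe measurable_subtype_coe]

end haar

end HaarHess

end

/-! ### The four cases -/

open MeasureTheory ProbabilityTheory HaarHess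
theorem theorem1 (m : ℕ) {Ω : Type*} [MeasurableSpace Ω] (P : Measure Ω) [IsProbabilityMeasure P] :
    -- the unitary group
    (∀ (α β : Fin m → Ω → ℂ) (θ : Ω → ℝ), IsComplexInput P m α β →
      HasLaw θ (ProbabilityTheory.cond volume (Set.Ioc (-Real.pi) Real.pi)) P →
      IndepFun (fun ω j => (α j ω, β j ω)) θ P →
      ∀ H : Ω → Matrix (Fin (m + 1)) (Fin (m + 1)) ℂ,
      (∀ ω, H ω = hessenbergProduct (fun j => α j ω) (fun j => β j ω)
        (-Complex.exp ((θ ω : ℂ) * Complex.I))) →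
      (∀ ω, H ω ∈ Matrix.unitaryGroup (Fin (m + 1)) ℂ ∧ IsUpperHessenberg (H ω)) ∧
      ∀ ν : Measure (Matrix.unitaryGroup (Fin (m + 1)) ℂ), IsNormalizedHaar ν →
        IdentDistrib (fun ω => eigenvalues (H ω))
          (fun Q : Matrix.unitaryGroup (Fin (m + 1)) ℂ => eigenvalues Q.1) P ν) ∧
    -- unitary matrices with determinant ξ (the special unitary group for ξ = 1, U = 1)
    (∀ (α β : Fin m → Ω → ℂ), IsComplexInput P m α β →
      ∀ ξ : ℂ, ‖ξ‖ = 1 →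
      ∀ H : Ω → Matrix (Fin (m + 1)) (Fin (m + 1)) ℂ,
      (∀ ω, H ω = hessenbergProduct (fun j => α j ω) (fun j => β j ω)
        (lastEntry ξ (fun j => α j ω))) →
      (∀ ω, H ω ∈ Matrix.unitaryGroup (Fin (m + 1)) ℂ ∧ IsUpperHessenberg (H ω)) ∧
      (∀ᵐ ω ∂P, (H ω).det = ξ) ∧
      ∀ ν : Measure (Matrix.specialUnitaryGroup (Fin (m + 1)) ℂ), IsNormalizedHaar ν →
      ∀ U ∈ Matrix.unitaryGroup (Fin (m + 1)) ℂ, U.det = ξ →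
        IdentDistrib (fun ω => eigenvalues (H ω))
          (fun Q : Matrix.specialUnitaryGroup (Fin (m + 1)) ℂ => eigenvalues (U * Q.1)) P ν) ∧
    -- the orthogonal group
    (∀ (α β : Fin m → Ω → ℝ) (θ : Ω → ℝ), IsRealInput P m α β →
      HasLaw θ (uniformOn {0, Real.pi}) P →
      IndepFun (fun ω j => (α j ω, β j ω)) θ P →
      ∀ H : Ω → Matrix (Fin (m + 1)) (Fin (m + 1)) ℂ,
      (∀ ω, H ω = hessenbergProduct (fun j => (α j ω : ℂ)) (fun j => (β j ω : ℂ))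
        (-Complex.exp ((θ ω : ℂ) * Complex.I))) →
      (∀ ω, IsUpperHessenberg (H ω)) ∧
      (∀ᵐ ω ∂P, ∃ Q ∈ Matrix.orthogonalGroup (Fin (m + 1)) ℝ, H ω = toComplex Q) ∧
      ∀ ν : Measure (Matrix.orthogonalGroup (Fin (m + 1)) ℝ), IsNormalizedHaar ν →
        IdentDistrib (fun ω => eigenvalues (H ω))
          (fun Q : Matrix.orthogonalGroup (Fin (m + 1)) ℝ => eigenvalues (toComplex Q.1)) P ν) ∧
    -- orthogonal matrices with determinant ξ (the special orthogonal group for ξ = 1, U = 1)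
    (∀ (α β : Fin m → Ω → ℝ), IsRealInput P m α β →
      ∀ ξ : ℝ, ξ = 1 ∨ ξ = -1 →
      ∀ H : Ω → Matrix (Fin (m + 1)) (Fin (m + 1)) ℂ,
      (∀ ω, H ω = hessenbergProduct (fun j => (α j ω : ℂ)) (fun j => (β j ω : ℂ))
        (lastEntry (ξ : ℂ) (fun j => (α j ω : ℂ)))) →
      (∀ ω, IsUpperHessenberg (H ω) ∧
        ∃ Q ∈ Matrix.orthogonalGroup (Fin (m + 1)) ℝ, H ω = toComplex Q) ∧
      (∀ᵐ ω ∂P, (H ω).det = (ξ : ℂ)) ∧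
      ∀ ν : Measure (Matrix.specialOrthogonalGroup (Fin (m + 1)) ℝ), IsNormalizedHaar ν →
      ∀ U ∈ Matrix.orthogonalGroup (Fin (m + 1)) ℝ, U.det = ξ →
        IdentDistrib (fun ω => eigenvalues (H ω))
          (fun Q : Matrix.specialOrthogonalGroup (Fin (m + 1)) ℝ =>
            eigenvalues (toComplex (U * Q.1))) P ν) := by
  refine ⟨?_, ?_, ?_, ?_⟩
  · intro α β θ h hθ hind H hH
    have hH' : ∀ ω, H ω = hess m (-Complex.exp ((θ ω : ℂ) * Complex.I) * ∏ j, unitPhase (α j ω))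
        fun j => (α j ω, β j ω) := fun ω => (hH ω).trans (hessenbergProduct_eq_hess _ _ _)
    refine ⟨fun ω => ?_, fun ν hν => ?_⟩
    · rw [hH']
      refine ⟨hess_mem_unitary m ?_ _, isUpperHessenberg_hess m _ _⟩
      rw [norm_mul, norm_prod_unitPhase, norm_neg, Complex.norm_exp_ofReal_mul_I, one_mul]
    · have hm : Measurable fun x : ℝ => -Complex.exp ((x : ℂ) * Complex.I) := by fun_prop
      have hζ := (HasLaw.mk (μ := (ProbabilityTheory.cond volume (Set.Ioc (-Real.pi) Real.pi)).map _)
        hm.aemeasurable rfl).comp hθ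
      simp only [hH']
      exact h.isScalarInput.identDistrib_unitary isIsotropic_complexGaussian isUniformPhase_complex hζ
        (hind.comp measurable_id hm) measurable_eigenvalues conjInvariant_eigenvalues hν
  · intro α β h ξ hξ H hH
    have hH' : ∀ ω, H ω = hess m ξ fun j => (α j ω, β j ω) := fun ω =>
      (hH ω).trans (hessenbergProduct_lastEntry _ _ _)
    simp only [hH']
    refine ⟨fun ω => ⟨hess_mem_unitary m hξ _, isUpperHessenberg_hess m _ _⟩, ?_, fun ν hν U hU hd => ?_⟩
    · filter_upwards [h.isScalarInput.ae_alpha_ne_zero isIsotropic_complexGaussian] with ω hω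
      exact det_hess m ξ hω
    · subst hd
      exact h.isScalarInput.identDistrib_special isIsotropic_complexGaussian measurable_eigenvalues
        conjInvariant_eigenvalues hν hU
  · intro α β θ h hθ hind H hH
    have hH1 : ∀ ω, H ω = hess m (-Complex.exp ((θ ω : ℂ) * Complex.I) *
        ∏ j, unitPhase (α j ω : ℂ)) fun j => ((α j ω : ℂ), (β j ω : ℂ)) := fun ω =>
      (hH ω).trans (hessenbergProduct_eq_hess _ _ _)
    have hm : Measurable fun x : ℝ => -Real.cos x := by fun_prop
    have hθmem : ∀ᵐ ω ∂P, θ ω ∈ ({0, Real.pi} : Set ℝ) := by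
      refine ae_of_ae_map hθ.aemeasurable ?_
      rw [hθ.map_eq]
      exact ae_cond_mem (Set.toFinite _).measurableSet
    -- Off the event `θ ∈ {0, π}` the last diagonal entry may fail to be real, so the real form
    -- holds only almost surely.
    have hH' : ∀ᵐ ω ∂P, H ω = toComplex (hess m (-Real.cos (θ ω) * ∏ j, unitPhase (α j ω))
        fun j => (α j ω, β j ω)) := by
      filter_upwards [hθmem] with ω hω
      have hz : -Complex.exp ((θ ω : ℂ) * Complex.I) = ((-Real.cos (θ ω) : ℝ) : ℂ) := by
        rcases hω with h0 | h0 <;> rw [h0] <;> simp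
      rw [hH1, toComplex_hess, hz]
      simp only [unitPhase_ofReal]
      push_cast
      rfl
    have hnorm : ∀ᵐ ω ∂P, ‖-Real.cos (θ ω) * ∏ j, unitPhase (α j ω)‖ = 1 := by
      filter_upwards [hθmem] with ω hω
      rw [norm_mul, norm_prod_unitPhase]
      rcases hω with h0 | h0 <;> rw [h0] <;> simp
    refine ⟨fun ω => ?_, ?_, fun ν hν => ?_⟩
    · rw [hH1]
      exact isUpperHessenberg_hess m _ _
    · filter_upwards [hH', hnorm] with ω hω h1
      exact ⟨_, hess_mem_unitary m h1 _, hω⟩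
    · have hζ := (HasLaw.mk (μ := (uniformOn {0, Real.pi}).map _) hm.aemeasurable rfl).comp hθ
      have key := h.isScalarInput.identDistrib_unitary isIsotropic_gaussianReal isUniformPhase_real hζ
        (hind.comp measurable_id hm) (measurable_eigenvalues.comp measurable_toComplex)
        conjInvariant_eigenvalues_toComplex hν
      -- The identity in law is proved for the real Hessenberg matrix, which agrees with `H` almost
      -- everywhere.
      refine IdentDistrib.trans (IdentDistrib.symm (IdentDistrib.of_ae_eq key.aemeasurable_fst ?_)) key
      filter_upwards [hH'] with ω hω
      rw [hω]
      rfl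
  · intro α β h ξ hξ H hH
    have hH' : ∀ ω, H ω = toComplex (hess m ξ fun j => (α j ω, β j ω)) := fun ω =>
      (hH ω).trans ((hessenbergProduct_lastEntry _ _ _).trans
        (toComplex_hess m ξ fun j => (α j ω, β j ω)).symm)
    have hnorm : ‖ξ‖ = 1 := by rcases hξ with rfl | rfl <;> simp
    simp only [hH']
    refine ⟨fun ω => ⟨?_, _, hess_mem_unitary m hnorm _, rfl⟩, ?_, fun ν hν U hU hd => ?_⟩
    · rw [toComplex_hess]
      exact isUpperHessenberg_hess m _ _
    · filter_upwards [h.isScalarInput.ae_alpha_ne_zero isIsotropic_gaussianReal] with ω hω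
      rw [det_toComplex, det_hess m ξ hω]
    · subst hd
      exact h.isScalarInput.identDistrib_special isIsotropic_gaussianReal
        (measurable_eigenvalues.comp measurable_toComplex) conjInvariant_eigenvalues_toComplex hν hU
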